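/- Graphs are finite and may have loops and multiple edges; a loop contributes $2$ to the degree of its vertex. A factor of a graph is a spanning subgraph. A graph is $k$-edge-connected if every nonempty proper subset of its vertex set is left by at least $k$ edges, and it is $m$-tree-connected if it contains $m$ pairwise edge-disjoint spanning trees. Let $m$ be a positive integer, let $G$ be a $2m$-edge-connected graph, let $z\in V(G)$, and let $M$ and $M_0$ be two edge-disjoint loopless factors of $G$ with $\Delta(M)\le m$ and $|E(M_0)|\le m$. Assume that $d_{M_0}(v)<m$ for all vertices $v$, except possibly for $z$. If $d_{M_0}(z)=m$ and $d_G(z)$ is even, assume also that the number of loops of $G$ at $z$ is even (for instance, that there are none). Then $G$ has an $m$-tree-connected factor $H$ which contains all edges of $M$ and no edge of $M_0$, such that for each vertex $v$, $$\left\lfloor\frac{d_G(v)}{2}\right\rfloor\le d_H(v)\le\left\lceil\frac{d_G(v)}{2}\right\rceil+m-d_{M_0}(v),$$ and such that, moreover, at the vertex $z$, $$d_H(z)\le\left\lfloor\frac{d_G(z)}{2}\right\rfloor+\max\{1,|E(M_0)|\}-d_{M_0}(z).$$ In particular $d_H(z)\le\lfloor d_G(z)/2\rfloor+m-d_{M_0}(z)$,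 and $d_H(z)\le\lfloor d_G(z)/2\rfloor+1-d_{M_0}(z)$ if $|E(M_0)|\le 1$. -/

import Mathlib

namespace Graph

/-- The degree of the vertex `v` in a finite multigraph, where every loop at `v` counts twice. -/
noncomputable def degree {α β : Type*} (G : Graph α β) (v : α) : ℕ :=
  (G.incidenceSet v).ncard + (G.loopSet v).ncard

/-- The set of edges of `G` with exactly one end in `A`. -/
def edgeCut {α β : Type*} (G : Graph α β) (A : Set α) : Set β :=
  {e | ∃ x y, G.IsLink e x y ∧ x ∈ A ∧ y ∉ A}

/-- `G` is `k`-edge-connected: every nonempty proper subset of the vertex set is left by at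
least `k` edges. -/
def EdgeConnected {α β : Type*} (G : Graph α β) (k : ℕ) : Prop :=
  ∀ A : Set α, A ⊂ G.vertexSet → A.Nonempty → k ≤ (G.edgeCut A).ncard

/-- There is a walk from `x` to `y` in `G`. -/
def Reachable {α β : Type*} (G : Graph α β) (x y : α) : Prop :=
  Relation.ReflTransGen G.Adj x y

/-- `T` is a tree: it is nonempty, connected, and no edge lies on a cycle, that is, deleting any
edge separates its two ends (in particular there are no loops). -/
structure IsTree {α β : Type*} (T : Graph α β) : Prop where
  nonempty : T.vertexSet.Nonempty
  reachable : ∀ x ∈ T.vertexSet, ∀ y ∈ T.vertexSet, T.Reachable x y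
  acyclic : ∀ e x y, T.IsLink e x y → ¬ (T.deleteEdges {e}).Reachable x y

/-- `H` is `m`-tree-connected: it contains `m` pairwise edge-disjoint spanning trees. -/
def TreeConnected {α β : Type*} (H : Graph α β) (m : ℕ) : Prop :=
  ∃ T : Fin m → Graph α β,
    (∀ i, (T i).IsSpanningSubgraph H ∧ (T i).IsTree) ∧
    ∀ i j, i ≠ j → Disjoint (T i).edgeSet (T j).edgeSet

end Graph

/-!
Let `d` be the degree function of `G`, and let every edge have two ends `a e`, `b e`.

*Halving the degrees.* The function `X ↦ e(X) + m`, with `e(X)` the number of edges inside `X`, is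
crossing supermodular, and by `2m`-edge-connectivity it is at most `∑ v ∈ X, d v / 2` for every
nonempty proper `X`. Uncrossing tight sets, the vector `d / 2` can be rounded to an integral vector
`p` with the same lower bounds, of sum `|E(G)|`, and rounded up at `z` (`exists_even_rounding`,
`exists_balanced_inDegree`). So `p` behaves like the in-degree vector of a smooth `m`-arc-connected
orientation, but no such orientation is needed.

*Trees and an oriented remainder.* Put `ℓ v = p v - m` for `v ≠ z` and `ℓ z = p z - |E(M₀)|`. The
edges outside `M₀` are covered by `m` forests and a set `R`, disjoint from `M`, whose edges have
heads such that at most `ℓ v` of them have head `v`. Indeed `R` is covered by `ℓ v` matroids of rank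
one for every `v`, so this is an instance of Edmonds' matroid partition theorem
(`exists_cover_of_card_le_sum`), and its rank condition follows, class by class, from the bounds for
`p` and from `Δ(M) ≤ m` (`card_inside_le`, `card_le_graphicRank_add`). As
`∑ ℓ v + m (|V| - 1) = |E(G)| - |E(M₀)|`, nothing is wasted: the forests are spanning trees, and the
in-degrees in `R` are exactly `ℓ v`. The graphic matroid is represented over `ℚ` by the differences
of the unit vectors of the ends, which makes its rank submodular at once.

*The degrees.* The set `C` of edges to be deleted from `R` must have its degrees in intervals
`[g v, f v]`. The in-degrees of `R` are at least `g`, its out-degrees at most `f`, the latter since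
every vertex, unless it is the only one, has degree at least `m` in the trees. Such a `C` exists by
a greedy argument: an edge whose head has in-degree more than `g` can be left out of `C`, one whose
head has out-degree less than `f` can be put into `C`, and counting shows that only loops at a
vertex with `g = f`, hence at `z`, can remain (`exists_subset_degree_between_of_even_loops`). This is where the parity of the
number of loops at `z` matters. The factor is `H = G - E(M₀) - C`.
-/

open Finset

/-! ### Integral rounding for crossing supermodular lower bounds -/

/-- An integral vector `q` in the base polyhedron of an even-valued crossing supermodular function
`i` can be rounded to an even vector `2 * p` in the same polyhedron, where odd coordinates move by
one and the coordinate of `z` does not go down. The odd coordinates are removed in pairs: some two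
of them are not separated by any tight set. -/
theorem exists_even_rounding {V : Type*} [Fintype V] [DecidableEq V] (i : Finset V → ℤ)
    (hi : ∀ X, Even (i X))
    (hsup : ∀ X Y : Finset V, (X ∩ Y).Nonempty → X ∪ Y ≠ univ →
      i X + i Y ≤ i (X ∩ Y) + i (X ∪ Y))
    (z : V) (n : ℕ) (q : V → ℤ) (hn : #{v | Odd (q v)} = n)
    (hqV : Even (∑ v, q v))
    (hq : ∀ X : Finset V, X.Nonempty → X ≠ univ → i X ≤ ∑ v ∈ X, q v) :
    ∃ p : V → ℤ, (∀ v, q v ≤ 2 * p v + 1 ∧ 2 * p v ≤ q v + 1) ∧ q z ≤ 2 * p z ∧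
      2 * ∑ v, p v = ∑ v, q v ∧
      ∀ X : Finset V, X.Nonempty → X ≠ univ → i X ≤ 2 * ∑ v ∈ X, p v := by
  induction n using Nat.strong_induction_on generalizing q with
  | _ n ih =>
  by_cases hodd : ∀ v, Even (q v)
  · choose p hp using fun v => (hodd v).two_dvd
    have hsum : ∀ X : Finset V, 2 * ∑ v ∈ X, p v = ∑ v ∈ X, q v := fun X => by
      rw [mul_sum]; exact sum_congr rfl fun v _ => (hp v).symm
    refine ⟨p, fun v => ⟨by rw [hp v]; linarith, by rw [hp v]; linarith⟩, (hp z).le, hsum _, ?_⟩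
    intro X h1 h2
    rw [hsum]; exact hq X h1 h2
  push Not at hodd
  obtain ⟨w, hw⟩ := hodd
  rw [Int.not_even_iff_odd] at hw
  -- a tight set is one whose lower bound is attained
  set tight : Finset V → Prop := fun T => T.Nonempty ∧ T ≠ univ ∧ ∑ v ∈ T, q v = i T with htight
  have htight_inter : ∀ X Y, tight X → tight Y → (X ∩ Y).Nonempty → X ∪ Y ≠ univ →
      tight (X ∩ Y) ∧ tight (X ∪ Y) := by
    rintro X Y ⟨hX, hX', hXi⟩ ⟨hY, hY', hYi⟩ h1 h2
    have h3 : X ∩ Y ≠ univ := fun h => hX' (univ_subset_iff.1 (h ▸ inter_subset_left))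
    have h4 := hq _ h1 h3
    have h5 := hq _ (hX.mono subset_union_left) h2
    have h6 := hsup X Y h1 h2
    have h7 := sum_union_inter (s₁ := X) (s₂ := Y) (f := q)
    exact ⟨⟨h1, h3, by linarith⟩, ⟨hX.mono subset_union_left, h2, by linarith⟩⟩
  -- two odd coordinates that no tight set separates
  obtain ⟨u, v, huv, hu, hv, hsep⟩ : ∃ u v, u ≠ v ∧ Odd (q u) ∧ Odd (q v) ∧
      ∀ T, tight T → (u ∈ T ↔ v ∈ T) := by
    have hpair : ∀ T : Finset V, Even (∑ v ∈ T, q v) → (∃ x ∈ T, Odd (q x)) →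
        ∃ x ∈ T, ∃ y ∈ T, x ≠ y ∧ Odd (q x) ∧ Odd (q y) := by
      rintro T hT ⟨x, hxT, hx⟩
      by_contra! hcon
      have h1 : Even (∑ v ∈ T.erase x, q v) := by
        refine even_sum _ fun y hy => ?_
        rw [← Int.not_odd_iff_even]
        exact fun h => by
          simpa [hx, h] using hcon x hxT y (mem_of_mem_erase hy) (ne_of_mem_erase hy).symm hx
      rw [← add_sum_erase _ _ hxT] at hT
      exact (Int.not_even_iff_odd.2 (hx.add_even h1)) hT
    -- complements of tight sets are included because uncrossing fails when the union is everything
    let S : Finset (Finset V) := {T | (tight T ∨ tight Tᶜ ∨ T = univ) ∧ ∃ x ∈ T, Odd (q x)}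
    have hSne : S.Nonempty := ⟨univ, by simp [S]; exact ⟨w, hw⟩⟩
    obtain ⟨T, hTS, hTmin⟩ := S.exists_min_image card hSne
    simp only [S, mem_filter, mem_univ, true_and] at hTS hTmin
    obtain ⟨hT, hTodd⟩ := hTS
    have hTeven : Even (∑ v ∈ T, q v) := by
      rcases hT with h | h | h
      · rw [h.2.2]; exact hi _
      · have := sum_add_sum_compl T q
        rw [h.2.2] at this
        rw [eq_sub_of_add_eq this]
        exact hqV.sub (hi _)
      · rwa [h]
    obtain ⟨a, ha, b, hb, hab, hao, hbo⟩ := hpair T hTeven hTodd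
    refine ⟨a, b, hab, hao, hbo, ?_⟩
    -- a smaller member of the family would contradict minimality
    have hno : ∀ T' : Finset V, (tight T' ∨ tight T'ᶜ) → T' ⊆ T → ∀ x y, Odd (q x) → x ∈ T' →
        y ∈ T → y ∉ T' → False := by
      intro T' h1 h2 x y hx hxT hyT hy
      have := hTmin T' ⟨by tauto, x, hxT, hx⟩
      exact absurd (card_lt_card ((ssubset_iff_of_subset h2).2 ⟨y, hyT, hy⟩)) (by omega)
    have key : ∀ x ∈ T, ∀ y ∈ T, Odd (q x) → Odd (q y) → ∀ T', tight T' → x ∈ T' → y ∈ T' := by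
      intro x hx y hy hxo hyo T' hT' hxT'
      by_contra hyT'
      rcases hT with h | h | h
      · by_cases hun : T ∪ T' = univ
        · refine hno T'ᶜ (Or.inr (by rwa [compl_compl])) ?_ y x hyo (by simpa) hx (by simpa)
          intro t ht
          have : t ∈ T ∪ T' := by rw [hun]; exact mem_univ _
          rcases mem_union.1 this with h | h
          · exact h
          · exact absurd h (mem_compl.1 ht)
        · exact hno (T ∩ T') (Or.inl (htight_inter T T' h hT' ⟨x, by simp [*]⟩ hun).1)
            inter_subset_left x y hxo (by simp [*]) hy (by simp [*])
      · by_cases hin : (Tᶜ ∩ T').Nonempty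
        · have hun : Tᶜ ∪ T' ≠ univ := fun h => by
            have : y ∈ Tᶜ ∪ T' := by rw [h]; exact mem_univ _
            simp [hy, hyT'] at this
          refine hno (Tᶜ ∪ T')ᶜ (Or.inr ?_) ?_ y x hyo (by simp [hy, hyT']) hx (by simp [hxT'])
          · rw [compl_compl]; exact (htight_inter _ T' h hT' hin hun).2
          · intro t ht; simp at ht; exact ht.1
        · refine hno T' (Or.inl hT') ?_ x y hxo hxT' hy hyT'
          intro t ht
          by_contra htT
          exact hin ⟨t, by simp [*]⟩
      · subst h
        exact hno T' (Or.inl hT') (subset_univ _) x y hxo hxT' hy hyT'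
    exact fun T' hT' => ⟨key a ha b hb hao hbo T' hT', key b hb a ha hbo hao T' hT'⟩
  -- arrange that `z` is not the coordinate which is rounded down
  wlog hvz : v ≠ z generalizing u v
  · exact this v u huv.symm hv hu (fun T hT => (hsep T hT).symm)
      (by rintro rfl; exact hvz huv.symm)
  -- since no tight set separates `u` and `v`, moving one unit from `v` to `u` is harmless
  set q' : V → ℤ := q + Pi.single u 1 - Pi.single v 1 with hq'
  have hq'u : q' u = q u + 1 := by simp [hq', huv]
  have hq'v : q' v = q v - 1 := by simp [hq', huv.symm]
  have hq'o : ∀ x, x ≠ u → x ≠ v → q' x = q x := fun x h1 h2 => by simp [hq', h1, h2]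
  have hsum : ∀ X : Finset V, ∑ x ∈ X, q' x =
      ∑ x ∈ X, q x + (if u ∈ X then 1 else 0) - (if v ∈ X then 1 else 0) := fun X => by
    simp [hq', sum_add_distrib, sum_sub_distrib, Pi.single_apply]
  have hlt : #{x | Odd (q' x)} < n := by
    rw [← hn]
    refine card_lt_card ((ssubset_iff_of_subset ?_).2 ⟨u, by simpa, ?_⟩)
    · intro x
      simp only [mem_filter, mem_univ, true_and]
      intro hx
      by_cases h1 : x = u
      · rwa [h1]
      by_cases h2 : x = v
      · rwa [h2]
      rwa [hq'o x h1 h2] at hx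
    · simp only [mem_filter, mem_univ, true_and, hq'u]
      exact Int.not_odd_iff_even.2 (hu.add_one)
  obtain ⟨p, hp1, hp2, hp3, hp4⟩ := ih _ hlt q' rfl (by rw [hsum]; simpa) (by
    intro X h1 h2
    rw [hsum]
    have h3 := hq X h1 h2
    by_cases ht : tight X
    · have := hsep X ht
      by_cases hX : u ∈ X
      · simp [hX, this.1 hX]; linarith
      · simp [hX, mt this.2 hX]; linarith
    · have : ∑ v ∈ X, q v ≠ i X := fun h => ht ⟨h1, h2, h⟩
      have : i X < ∑ v ∈ X, q v := lt_of_le_of_ne h3 this.symm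
      split_ifs <;> linarith)
  refine ⟨p, fun x => ?_, ?_, by rw [hp3, hsum]; simp, hp4⟩
  · have := hp1 x
    by_cases h1 : x = u
    · subst h1
      rw [hq'u] at this
      obtain ⟨k, hk⟩ := hu
      omega
    by_cases h2 : x = v
    · subst h2
      rw [hq'v] at this
      obtain ⟨k, hk⟩ := hv
      omega
    rwa [hq'o x h1 h2] at this
  · by_cases h1 : z = u
    · subst h1; linarith
    · rwa [hq'o z h1 hvz.symm] at hp2

/-! ### Covering by submodular rank functions -/

/-- The matroid partition theorem, in the form of Rado's theorem for submodular functions: if no set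
`F` is larger than the sum of its ranks, then the elements can be labelled so that each label class
is independent for its rank function. Starting with all labels allowed everywhere, labels are
discarded as long as some element has two of them; submodularity shows that one of two labels can
always be discarded. -/
theorem exists_cover_of_card_le_sum {ι E : Type*} [Fintype ι] [DecidableEq ι] [Nonempty ι]
    [DecidableEq E] (r : ι → Finset E → ℕ) (h0 : ∀ i, r i ∅ = 0) (hmono : ∀ i, Monotone (r i))
    (hsub : ∀ i S T, r i (S ∪ T) + r i (S ∩ T) ≤ r i S + r i T)
    (E₀ : Finset E) (hcard : ∀ F ⊆ E₀, #F ≤ ∑ i, r i F) :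
    ∃ c : E → ι, ∀ i, ∀ F ⊆ E₀, (∀ e ∈ F, c e = i) → #F ≤ r i F := by
  suffices h : ∀ (n : ℕ) (A : E → Finset ι), ∑ e ∈ E₀, #(A e) = n →
      (∀ F ⊆ E₀, #F ≤ ∑ i, r i {e ∈ F | i ∈ A e}) →
      ∃ c : E → ι, ∀ i, ∀ F ⊆ E₀, (∀ e ∈ F, c e = i) → #F ≤ r i F from
    h _ (fun _ => univ) rfl (by simpa using hcard)
  intro n
  induction n using Nat.strong_induction_on with
  | _ n ih =>
  intro A hn hA
  by_cases hone : ∀ e ∈ E₀, #(A e) ≤ 1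
  · have hne : ∀ e ∈ E₀, (A e).Nonempty := by
      intro e he
      by_contra hcon
      rw [not_nonempty_iff_eq_empty] at hcon
      have := hA {e} (by simpa)
      simp [filter_singleton, hcon, h0] at this
    have hc : ∀ e, ∃ i, e ∈ E₀ → A e = {i} := by
      intro e
      by_cases he : e ∈ E₀
      · obtain ⟨i, hi⟩ := card_eq_one.1 (le_antisymm (hone e he) (card_pos.2 (hne e he)))
        exact ⟨i, fun _ => hi⟩
      · exact ⟨Classical.arbitrary ι, fun h => absurd h he⟩
    choose c hc using hc
    refine ⟨c, fun i F hF hFi => (hA F hF).trans_eq ?_⟩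
    have hiff : ∀ j, ∀ e ∈ F, (j ∈ A e ↔ j = i) := fun j e he => by
      rw [hc e (hF he), mem_singleton, hFi e he]
    rw [sum_eq_single i]
    · rw [filter_true_of_mem fun e he => (hiff i e he).2 rfl]
    · intro j _ hj
      rw [filter_false_of_mem fun e he => mt (hiff j e he).1 hj, h0]
    · simp
  push Not at hone
  obtain ⟨e₀, he₀, hlt⟩ := hone
  obtain ⟨x, hx, y, hy, hxy⟩ := one_lt_card.1 hlt
  -- one of the two labels can be removed from the list of `e₀`
  let B : ι → E → Finset ι := fun t => Function.update A e₀ ((A e₀).erase t)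
  have hBcard : ∀ t ∈ A e₀, ∑ e ∈ E₀, #(B t e) < n := by
    intro t ht
    rw [← hn]
    refine sum_lt_sum (fun e _ => ?_) ⟨e₀, he₀, ?_⟩
    · by_cases h : e = e₀
      · subst h; simpa [B] using card_le_card (erase_subset t _)
      · simp [B, h]
    · simpa [B] using card_erase_lt_of_mem ht
  by_cases h1 : ∀ F ⊆ E₀, #F ≤ ∑ i, r i {e ∈ F | i ∈ B x e}
  · exact ih _ (hBcard x hx) _ rfl h1
  by_cases h2 : ∀ F ⊆ E₀, #F ≤ ∑ i, r i {e ∈ F | i ∈ B y e}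
  · exact ih _ (hBcard y hy) _ rfl h2
  exfalso
  push Not at h1 h2
  obtain ⟨J, hJ, hJlt⟩ := h1
  obtain ⟨K, hK, hKlt⟩ := h2
  have hmem : ∀ t, ∀ F ⊆ E₀, ∑ i, r i {e ∈ F | i ∈ B t e} < #F → e₀ ∈ F := by
    intro t F hF hlt
    by_contra hcon
    refine absurd (hA F hF) (not_le.2 (lt_of_eq_of_lt (sum_congr rfl fun i _ => ?_) hlt))
    congr 1
    refine filter_congr fun e he => ?_
    have : e ≠ e₀ := by rintro rfl; exact hcon he
    simp [B, this]
  have hJ0 := hmem x J hJ hJlt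
  have hK0 := hmem y K hK hKlt
  have hle : ∀ i, r i {e ∈ J ∪ K | i ∈ A e} + r i {e ∈ (J ∩ K).erase e₀ | i ∈ A e} ≤
      r i {e ∈ J | i ∈ B x e} + r i {e ∈ K | i ∈ B y e} := by
    intro i
    refine le_trans (add_le_add (hmono i ?_) (hmono i ?_)) (hsub i _ _)
    · intro e he
      simp only [mem_filter, mem_union] at he ⊢
      by_cases h : e = e₀
      · subst h
        by_cases hix : i = x
        · subst hix; right; simp [B, hK0, hxy, he.2]
        · left; simp [B, hJ0, hix, he.2]
      · simp only [B, Function.update_of_ne h]; tauto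
    · intro e he
      simp only [mem_filter, mem_inter, mem_erase] at he ⊢
      simp only [B, Function.update_of_ne he.1.1]; tauto
  have hsum := sum_le_sum fun i (_ : i ∈ univ) => hle i
  rw [sum_add_distrib, sum_add_distrib] at hsum
  have h3 := hA (J ∪ K) (union_subset hJ hK)
  have h4 := hA ((J ∩ K).erase e₀) ((erase_subset _ _).trans (inter_subset_left.trans hJ))
  have h5 : #((J ∩ K).erase e₀) = #(J ∩ K) - 1 := card_erase_of_mem (by simp [hJ0, hK0])
  have h6 := card_union_add_card_inter J K
  have h7 : 0 < #(J ∩ K) := card_pos.2 ⟨e₀, by simp [hJ0, hK0]⟩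
  omega

/-! ### Degree-constrained factors of oriented multigraphs -/

/-- `endCount a F v` is the number of edges of `F` whose end selected by `a` is the vertex `v`. -/
def endCount {V E : Type*} [DecidableEq V] (a : E → V) (F : Finset E) (v : V) : ℕ :=
  #{e ∈ F | a e = v}

section endCount

variable {V E : Type*} [DecidableEq V] (a : E → V)

theorem endCount_mono {F F' : Finset E} (h : F ⊆ F') (v : V) :
    endCount a F v ≤ endCount a F' v :=
  card_le_card (filter_subset_filter _ h)

theorem sum_endCount (F : Finset E) (X : Finset V) :
    ∑ v ∈ X, endCount a F v = #{e ∈ F | a e ∈ X} := by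
  rw [card_eq_sum_card_fiberwise (f := a) (t := X) (s := {e ∈ F | a e ∈ X})]
  · refine sum_congr rfl fun v hv => ?_
    rw [filter_filter, endCount]
    congr 1
    refine filter_congr fun e _ => ⟨fun h => ⟨h ▸ hv, h⟩, fun h => h.2⟩
  · intro e he
    exact (mem_filter.1 (mem_coe.1 he)).2

variable [DecidableEq E]

theorem endCount_sdiff {F F' : Finset E} (h : F' ⊆ F) (v : V) :
    endCount a (F \ F') v + endCount a F' v = endCount a F v := by
  rw [endCount, endCount, endCount, ← card_union_of_disjoint, ← filter_union,
    sdiff_union_of_subset h]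
  exact disjoint_filter_filter sdiff_disjoint

theorem endCount_erase {F : Finset E} {e : E} (h : e ∈ F) (v : V) :
    endCount a (F.erase e) v + (if a e = v then 1 else 0) = endCount a F v := by
  rw [erase_eq, ← endCount_sdiff a (singleton_subset_iff.2 h) v]
  simp [endCount, filter_singleton, apply_ite card]

theorem endCount_insert {F : Finset E} {e : E} (h : e ∉ F) (v : V) :
    endCount a (insert e F) v = endCount a F v + (if a e = v then 1 else 0) := by
  rw [← endCount_erase a (mem_insert_self e F) v, erase_insert h]

end endCount

/-- An edge set `R` with heads `h` and tails `t`, whose in-degrees are at least `g` and whose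
out-degrees are at most `f`, has a subset whose total degrees lie between `g` and `f`. Edges are
decided one at a time, so that the two bounds survive for the undecided edges. With `g z = f z`,
undecided loops at `z` are kept to the end, when half of them are taken. -/
theorem exists_subset_degree_between_of_even_loops {V E : Type*} [Fintype V] [DecidableEq V]
    [DecidableEq E] (h t : E → V) (z : V) (n : ℕ) (R : Finset E) (hn : #R = n) (g f : V → ℤ)
    (hg : ∀ v, g v ≤ endCount h R v) (hf : ∀ v, (endCount t R v : ℤ) ≤ f v)
    (hgf : ∀ v, g v ≤ f v) (hgf' : ∀ v, v ≠ z → g v < f v)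
    (hz : g z = f z → Even #{e ∈ R | h e = z ∧ t e = z}) :
    ∃ C ⊆ R, ∀ v, g v ≤ endCount h C v + endCount t C v ∧
      (endCount h C v + endCount t C v : ℤ) ≤ f v := by
  induction n generalizing R g f with
  | zero =>
    rw [card_eq_zero] at hn
    subst hn
    exact ⟨∅, Subset.rfl, fun v => ⟨by simpa [endCount] using hg v, by simpa [endCount] using hf v⟩⟩
  | succ n ih =>
  -- the arcs that may be decided one by one: all but the loops at a vertex with `g = f`
  set N : Finset E := {e ∈ R | ¬ (h e = z ∧ t e = z ∧ g z = f z)} with hN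
  have hloops : ∀ e ∈ N, g z = f z →
      {e' ∈ R.erase e | h e' = z ∧ t e' = z} = ({e' ∈ R | h e' = z ∧ t e' = z} : Finset E) := by
    intro e he hzz
    rw [filter_erase, erase_eq_of_notMem]
    simp only [hN, mem_filter] at he ⊢
    tauto
  by_cases hdel : ∃ e ∈ N, g (h e) < endCount h R (h e)
  · obtain ⟨e, he, hlt⟩ := hdel
    have heR : e ∈ R := (mem_filter.1 he).1
    obtain ⟨C, hC, hC'⟩ := ih (R.erase e) (by rw [card_erase_of_mem heR, hn]; rfl) g f
      (fun v => by
        have h1 := endCount_erase h heR v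
        by_cases h2 : h e = v
        · subst h2; simp at h1; omega
        · simp [h2] at h1; rw [h1]; exact hg v)
      (fun v => (Nat.cast_le.2 (endCount_mono t (erase_subset e R) v)).trans (hf v)) hgf hgf'
      (fun hzz => by rw [hloops e he hzz]; exact hz hzz)
    exact ⟨C, hC.trans (erase_subset _ _), hC'⟩
  by_cases hinc : ∃ e ∈ N, (endCount t R (h e) : ℤ) < f (h e)
  · obtain ⟨e, he, hlt⟩ := hinc
    have heR : e ∈ R := (mem_filter.1 he).1
    let s : V → ℤ := fun v => (if h e = v then 1 else 0) + (if t e = v then 1 else 0)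
    obtain ⟨C, hC, hC'⟩ := ih (R.erase e) (by rw [card_erase_of_mem heR, hn]; rfl)
      (fun v => g v - s v) (fun v => f v - s v)
      (fun v => by
        have h1 := endCount_erase h heR v
        have h2 := hg v
        simp only [s]
        split_ifs at h1 ⊢ <;> omega)
      (fun v => by
        have h1 := endCount_erase t heR v
        have h2 := hf v
        by_cases h3 : h e = v
        · subst h3
          simp only [s]
          split_ifs at h1 ⊢ <;> omega
        · simp only [s, if_neg h3]
          split_ifs at h1 ⊢ <;> omega)
      (fun v => by have := hgf v; omega) (fun v hv => by have := hgf' v hv; omega)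
      (fun hzz => by
        have hzz : g z = f z := by omega
        rw [hloops e he hzz]; exact hz hzz)
    have heC : e ∉ C := fun h => by simpa using hC h
    refine ⟨insert e C, insert_subset heR (hC.trans (erase_subset _ _)), fun v => ?_⟩
    have h1 := hC' v
    rw [endCount_insert h heC, endCount_insert t heC]
    simp only [s] at h1
    push_cast
    omega
  push Not at hdel hinc
  -- no arc can be decided: then only loops at `z` are left
  have hNR : N ⊆ R := filter_subset _ _
  have hNe : N = ∅ := by
    let W : Finset V := N.image h
    have hW : ∀ v ∈ W, endCount h N v ≤ endCount t N v ∧ (v ≠ z → endCount h N v < endCount t N v) ∧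
        (v = z → g z < f z → endCount h N v < endCount t N v) := by
      intro v hv
      obtain ⟨e, he, rfl⟩ := mem_image.1 hv
      have h1 := hdel e he
      have h2 := hinc e he
      have h3 : endCount h (R \ N) (h e) = endCount t (R \ N) (h e) := by
        have : ∀ e' ∈ R \ N, h e' = z ∧ t e' = z := by
          intro e' he'
          simp only [hN, mem_sdiff, mem_filter] at he'
          tauto
        unfold endCount
        congr 1
        refine filter_congr fun e' he' => ?_
        rw [(this e' he').1, (this e' he').2]
      have h4 := endCount_sdiff h hNR (h e)
      have h5 := endCount_sdiff t hNR (h e)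
      have h6 := hgf (h e)
      refine ⟨by omega, fun h7 => by have := hgf' _ h7; omega, fun h7 h8 => ?_⟩
      rw [h7] at h1 h2 h3 h4 h5 h6 ⊢
      omega
    have h1 : ∑ v ∈ W, endCount h N v = #N := by
      rw [sum_endCount, filter_true_of_mem fun e he => mem_image_of_mem _ he]
    have h2 : ∑ v ∈ W, endCount t N v ≤ #N := by
      rw [sum_endCount]; exact card_filter_le _ _
    have h3 : ∀ v ∈ W, endCount h N v = endCount t N v :=
      (sum_eq_sum_iff_of_le fun v hv => (hW v hv).1).1
        (le_antisymm (sum_le_sum fun v hv => (hW v hv).1) (h2.trans_eq h1.symm))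
    have h4 : ∀ v ∈ W, v = z ∧ ¬ g z < f z := by
      intro v hv
      have h5 := hW v hv
      have h6 := h3 v hv
      by_cases h7 : v = z
      · exact ⟨h7, fun h8 => by have := h5.2.2 h7 h8; omega⟩
      · have := h5.2.1 h7; omega
    by_contra hne
    obtain ⟨e, he⟩ := nonempty_iff_ne_empty.2 hne
    have h5 := h4 _ (mem_image_of_mem h he)
    have h6 : #{e ∈ N | t e ∈ W} = #N := by
      rw [← sum_endCount, ← h1]; exact (sum_congr rfl h3).symm
    have h7 := h4 _ (card_filter_eq_iff.1 h6 e he)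
    have h8 := (mem_filter.1 he).2
    have := hgf z
    exact h8 ⟨h5.1, h7.1, by omega⟩
  have hR : ∀ e ∈ R, h e = z ∧ t e = z ∧ g z = f z := by
    intro e he
    by_contra hcon
    have : e ∈ N := mem_filter.2 ⟨he, hcon⟩
    simp [hNe] at this
  have hRne : R.Nonempty := card_pos.1 (by omega)
  obtain ⟨e, he⟩ := hRne
  have hzz := (hR e he).2.2
  have heven := hz hzz
  rw [filter_true_of_mem fun e he => ⟨(hR e he).1, (hR e he).2.1⟩] at heven
  obtain ⟨k, hk⟩ := heven
  obtain ⟨C, hC, hCk⟩ := exists_subset_card_eq (s := R) (n := k) (by omega)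
  refine ⟨C, hC, fun v => ?_⟩
  by_cases hv : v = z
  · subst hv
    have h1 : ∀ F ⊆ R, endCount h F v = #F ∧ endCount t F v = #F := fun F hF =>
      ⟨by rw [endCount, filter_true_of_mem fun e he => (hR e (hF he)).1],
        by rw [endCount, filter_true_of_mem fun e he => (hR e (hF he)).2.1]⟩
    have h2 := hg v
    have h3 := hf v
    rw [(h1 R Subset.rfl).1] at h2
    rw [(h1 R Subset.rfl).2] at h3
    rw [(h1 C hC).1, (h1 C hC).2]
    omega
  · have h1 : ∀ F ⊆ R, endCount h F v = 0 ∧ endCount t F v = 0 := fun F hF =>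
      ⟨card_eq_zero.2 (filter_false_of_mem fun e he => by
          rw [(hR e (hF he)).1]; exact Ne.symm hv),
        card_eq_zero.2 (filter_false_of_mem fun e he => by
          rw [(hR e (hF he)).2.1]; exact Ne.symm hv)⟩
    have h2 := hg v
    have h3 := hf v
    rw [(h1 R Subset.rfl).1] at h2
    rw [(h1 R Subset.rfl).2] at h3
    rw [(h1 C hC).1, (h1 C hC).2]
    omega

/-- The same with another way to deal with an odd number of loops at `z`: if the out-degree of `z`
is less than `f z`, one loop can be taken at the start. -/
theorem exists_subset_degree_between {V E : Type*} [Fintype V] [DecidableEq V]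
    [DecidableEq E] (h t : E → V) (z : V) (R : Finset E) (g f : V → ℤ)
    (hg : ∀ v, g v ≤ endCount h R v) (hf : ∀ v, (endCount t R v : ℤ) ≤ f v)
    (hgf : ∀ v, g v ≤ f v) (hgf' : ∀ v, v ≠ z → g v < f v)
    (hz : g z = f z → Even #{e ∈ R | h e = z ∧ t e = z} ∨ (endCount t R z : ℤ) < f z) :
    ∃ C ⊆ R, ∀ v, g v ≤ endCount h C v + endCount t C v ∧
      (endCount h C v + endCount t C v : ℤ) ≤ f v := by
  by_cases heven : g z = f z → Even #{e ∈ R | h e = z ∧ t e = z}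
  · exact exists_subset_degree_between_of_even_loops h t z _ R rfl g f hg hf hgf hgf' heven
  push Not at heven
  obtain ⟨hzz, hodd⟩ := heven
  have hlt := (hz hzz).resolve_left hodd
  rw [Nat.not_even_iff_odd] at hodd
  obtain ⟨e, he⟩ := card_pos.1 hodd.pos
  have ⟨heR, hhe, hte⟩ : e ∈ R ∧ h e = z ∧ t e = z := by simpa using he
  -- put one loop at `z` into the factor, which makes the number of remaining loops even
  let s : V → ℤ := fun v => if z = v then 2 else 0
  obtain ⟨C, hC, hC'⟩ := exists_subset_degree_between_of_even_loops h t z _ (R.erase e) rfl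
    (fun v => g v - s v) (fun v => f v - s v)
    (fun v => by
      have h1 := endCount_erase h heR v
      have h2 := hg v
      rw [hhe] at h1
      simp only [s]
      split_ifs at h1 ⊢ <;> omega)
    (fun v => by
      have h1 := endCount_erase t heR v
      have h2 := hf v
      rw [hte] at h1
      by_cases h3 : z = v
      · subst h3
        simp [s] at h1 ⊢; omega
      · simp [s, h3] at h1 ⊢; omega)
    (fun v => by have := hgf v; omega) (fun v hv => by have := hgf' v hv; omega)
    (fun _ => by
      rw [filter_erase, card_erase_of_mem he]
      exact hodd.tsub_odd odd_one)
  have heC : e ∉ C := fun h => by simpa using hC h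
  refine ⟨insert e C, insert_subset heR (hC.trans (erase_subset _ _)), fun v => ?_⟩
  have h1 := hC' v
  rw [endCount_insert h heC, endCount_insert t heC, hhe, hte]
  simp only [s] at h1
  push_cast
  split_ifs at h1 ⊢ <;> omega

/-! ### The graphic rank -/

/-- The vector in `ℚ^V` which the graphic matroid assigns to the edge `e` with ends `a e` and
`b e`. -/
def edgeVec {V E : Type*} [DecidableEq V] (a b : E → V) (e : E) : V → ℚ :=
  Pi.single (a e) 1 - Pi.single (b e) 1

/-- The subspace of `ℚ^V` spanned by the vectors of the edges in `F`. -/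
def edgeSpan {V E : Type*} [DecidableEq V] (a b : E → V) (F : Finset E) : Submodule ℚ (V → ℚ) :=
  Submodule.span ℚ (edgeVec a b '' F)

/-- The rank of the edge set `F` in the graphic matroid. -/
noncomputable def graphicRank {V E : Type*} [DecidableEq V] (a b : E → V) (F : Finset E) : ℕ :=
  Module.finrank ℚ (edgeSpan a b F)

section graphicRank

variable {V E : Type*} [DecidableEq V] (a b : E → V)

theorem edgeVec_mem_edgeSpan {F : Finset E} {e : E} (he : e ∈ F) :
    edgeVec a b e ∈ edgeSpan a b F :=
  Submodule.subset_span ⟨e, he, rfl⟩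

theorem edgeSpan_mono : Monotone (edgeSpan a b) := fun _ _ h =>
  Submodule.span_mono (Set.image_mono h)

theorem graphicRank_empty : graphicRank a b ∅ = 0 := by
  rw [graphicRank, edgeSpan, coe_empty, Set.image_empty, Submodule.span_empty, finrank_bot]

theorem graphicRank_singleton_of_loop {e : E} (he : a e = b e) : graphicRank a b {e} = 0 := by
  rw [graphicRank, edgeSpan, coe_singleton, Set.image_singleton, edgeVec, he, sub_self,
    Submodule.span_zero_singleton, finrank_bot]

variable [Fintype V]

theorem graphicRank_mono : Monotone (graphicRank a b) := fun _ _ h =>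
  Submodule.finrank_mono (edgeSpan_mono a b h)

theorem graphicRank_submodular [DecidableEq E] (S T : Finset E) :
    graphicRank a b (S ∪ T) + graphicRank a b (S ∩ T) ≤ graphicRank a b S + graphicRank a b T := by
  have h1 : edgeSpan a b (S ∪ T) = edgeSpan a b S ⊔ edgeSpan a b T := by
    rw [edgeSpan, coe_union, Set.image_union, Submodule.span_union]; rfl
  have h2 : edgeSpan a b (S ∩ T) ≤ edgeSpan a b S ⊓ edgeSpan a b T :=
    le_inf (edgeSpan_mono a b inter_subset_left) (edgeSpan_mono a b inter_subset_right)
  have h3 := Submodule.finrank_sup_add_finrank_inf_eq (edgeSpan a b S) (edgeSpan a b T)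
  have h4 := Submodule.finrank_mono h2
  unfold graphicRank
  rw [h1]
  omega

theorem edgeSpan_le_ker_sum (F : Finset E) :
    edgeSpan a b F ≤ LinearMap.ker (∑ v, LinearMap.proj v : (V → ℚ) →ₗ[ℚ] ℚ) := by
  rw [edgeSpan, Submodule.span_le]
  rintro _ ⟨e, _, rfl⟩
  simp [edgeVec, Pi.single_apply]

theorem finrank_ker_sum [Nonempty V] :
    Module.finrank ℚ (LinearMap.ker (∑ v, LinearMap.proj v : (V → ℚ) →ₗ[ℚ] ℚ)) + 1 =
      Fintype.card V := by
  have h := LinearMap.finrank_range_add_finrank_ker (∑ v, LinearMap.proj v : (V → ℚ) →ₗ[ℚ] ℚ)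
  have hs : Function.Surjective (∑ v, LinearMap.proj v : (V → ℚ) →ₗ[ℚ] ℚ) := fun y =>
    ⟨Pi.single (Classical.arbitrary V) y, by simp [Pi.single_apply]⟩
  rw [LinearMap.range_eq_top.2 hs, finrank_top, Module.finrank_self,
    Module.finrank_fintype_fun_eq_card] at h
  omega

theorem graphicRank_lt_card [Nonempty V] (F : Finset E) :
    graphicRank a b F + 1 ≤ Fintype.card V := by
  rw [← finrank_ker_sum (V := V)]
  exact Nat.add_le_add_right (Submodule.finrank_mono (edgeSpan_le_ker_sum a b F)) 1

/-- Every edge set `F` splits the vertex set into classes (the fibres of `c`), each a union of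
components, whose number is at most `|V|` minus the rank of `F`. -/
theorem exists_classes (F : Finset E) :
    ∃ c : V → V, (∀ e ∈ F, c (a e) = c (b e)) ∧
      Fintype.card V ≤ graphicRank a b F + #(univ.image c) := by
  let s : Setoid V :=
    { r := fun u v => (Pi.single u 1 - Pi.single v 1 : V → ℚ) ∈ edgeSpan a b F
      iseqv := ⟨fun u => by simp, fun {u v} h => by simpa using (edgeSpan a b F).neg_mem h,
        fun {u v w} h1 h2 => by simpa using (edgeSpan a b F).add_mem h1 h2⟩ }
  let c : V → V := fun v => (Quotient.mk s v).out
  have hc : ∀ v, (Pi.single v 1 - Pi.single (c v) 1 : V → ℚ) ∈ edgeSpan a b F := fun v =>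
    s.symm (Quotient.exact (Quotient.out_eq (Quotient.mk s v)))
  refine ⟨c, fun e he => ?_, ?_⟩
  · have : Quotient.mk s (a e) = Quotient.mk s (b e) :=
      Quotient.sound (edgeVec_mem_edgeSpan a b he)
    simp only [c, this]
  · let K : Finset (V → ℚ) := (univ.image c).image fun v => Pi.single v 1
    have htop : edgeSpan a b F ⊔ Submodule.span ℚ (K : Set (V → ℚ)) = ⊤ := by
      rw [eq_top_iff, ← (Pi.basisFun ℚ V).span_eq, Submodule.span_le]
      rintro _ ⟨v, rfl⟩
      rw [Pi.basisFun_apply, ← sub_add_cancel (Pi.single v 1) (Pi.single (c v) (1 : ℚ))]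
      refine Submodule.add_mem_sup (hc v) (Submodule.subset_span ?_)
      exact mem_coe.2 (mem_image_of_mem _ (mem_image_of_mem _ (mem_univ _)))
    have h1 := Submodule.finrank_sup_add_finrank_inf_eq (edgeSpan a b F)
      (Submodule.span ℚ (K : Set (V → ℚ)))
    rw [htop, finrank_top, Module.finrank_fintype_fun_eq_card] at h1
    have h2 : Module.finrank ℚ (Submodule.span ℚ (K : Set (V → ℚ))) ≤ #K :=
      finrank_span_finset_le_card K
    have h3 : #K ≤ #(univ.image c) := card_image_le
    unfold graphicRank
    omega

/-- An edge set of full rank connects every two vertices, in the dual form: a vertex set which no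
edge leaves and which contains `x` contains every vertex. -/
theorem mem_of_graphicRank_add_one_eq_card [Nonempty V] {F : Finset E}
    (hF : Fintype.card V ≤ graphicRank a b F + 1) (A : Set V)
    (hA : ∀ e ∈ F, a e ∈ A ↔ b e ∈ A) {x : V} (hx : x ∈ A) (y : V) : y ∈ A := by
  classical
  have hspan := Submodule.eq_of_le_of_finrank_le (edgeSpan_le_ker_sum a b F)
    (by have := finrank_ker_sum (V := V); unfold graphicRank at hF; omega)
  let φ : (V → ℚ) →ₗ[ℚ] ℚ := ∑ v with v ∈ A, LinearMap.proj v
  have hφ : ∀ v, φ (Pi.single v 1) = if v ∈ A then 1 else 0 := fun v => by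
    simp [φ, Pi.single_apply]
  have hker : edgeSpan a b F ≤ LinearMap.ker φ := by
    rw [edgeSpan, Submodule.span_le]
    rintro _ ⟨e, he, rfl⟩
    simp [edgeVec, hφ, hA e he]
  have hmem : (Pi.single x 1 - Pi.single y 1 : V → ℚ) ∈ edgeSpan a b F := by
    rw [hspan]; simp [Pi.single_apply]
  have := hker hmem
  rw [LinearMap.mem_ker, map_sub, hφ, hφ, if_pos hx] at this
  by_contra hy
  simp [hy] at this

/-- In an edge set whose size is at most its rank, no edge is spanned by the others. -/
theorem edgeVec_notMem_edgeSpan_erase [DecidableEq E] {F : Finset E}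
    (hF : #F ≤ graphicRank a b F) {e : E} (he : e ∈ F) :
    edgeVec a b e ∉ edgeSpan a b (F.erase e) := by
  intro hmem
  have h1 : edgeSpan a b F ≤ edgeSpan a b (F.erase e) := by
    rw [edgeSpan, Submodule.span_le]
    rintro _ ⟨e', he', rfl⟩
    by_cases h : e' = e
    · rwa [h]
    · exact edgeVec_mem_edgeSpan a b (mem_erase.2 ⟨h, he'⟩)
  have h2 := Submodule.finrank_mono h1
  have h3 : Module.finrank ℚ (edgeSpan a b (F.erase e)) ≤ #(F.erase e) := by
    classical
    have := finrank_span_finset_le_card (R := ℚ) ((F.erase e).image (edgeVec a b))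
    rw [coe_image] at this
    exact this.trans card_image_le
  have h4 := card_erase_lt_of_mem he
  unfold graphicRank at hF
  omega

end graphicRank

/-! ### Balanced in-degree vectors -/

/-- The degree of `v` with respect to the edge set `F`, where loops count twice. -/
def endDegree {V E : Type*} [DecidableEq V] (a b : E → V) (F : Finset E) (v : V) : ℕ :=
  endCount a F v + endCount b F v

section endDegree

variable {V E : Type*} [DecidableEq V] (a b : E → V)

theorem sum_endDegree (F : Finset E) (X : Finset V) :
    ∑ v ∈ X, endDegree a b F v =
      2 * #{e ∈ F | a e ∈ X ∧ b e ∈ X} + #{e ∈ F | ¬ (a e ∈ X ↔ b e ∈ X)} := by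
  simp only [endDegree, sum_add_distrib, sum_endCount, card_filter, mul_sum]
  rw [← sum_add_distrib, ← sum_add_distrib]
  refine sum_congr rfl fun e _ => ?_
  by_cases h1 : a e ∈ X <;> by_cases h2 : b e ∈ X <;> simp [h1, h2]

theorem card_touching_le_sum_endDegree (F : Finset E) (X : Finset V) :
    #{e ∈ F | a e ∈ X ∨ b e ∈ X} ≤ ∑ v ∈ X, endDegree a b F v := by
  rw [sum_endDegree]
  simp only [card_filter, mul_sum]
  rw [← sum_add_distrib]
  refine sum_le_sum fun e _ => ?_
  by_cases h1 : a e ∈ X <;> by_cases h2 : b e ∈ X <;> simp [h1, h2]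

theorem endDegree_sdiff [DecidableEq E] {F F' : Finset E} (h : F' ⊆ F) (v : V) :
    endDegree a b (F \ F') v + endDegree a b F' v = endDegree a b F v := by
  have h1 := endCount_sdiff a h v
  have h2 := endCount_sdiff b h v
  unfold endDegree
  omega

theorem endDegree_le_card_of_loopless {F : Finset E} (hF : ∀ e ∈ F, a e ≠ b e) (v : V) :
    endDegree a b F v ≤ #F := by
  rw [endDegree, endCount, endCount, card_filter, card_filter, ← sum_add_distrib, card_eq_sum_ones]
  refine sum_le_sum fun e he => ?_
  have := hF e he
  split_ifs with h1 h2
  · exact absurd (h1.trans h2.symm) this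
  all_goals simp

/-- In a `2m`-edge-connected graph the degrees can be halved, with rounding, to a vector which has
the properties of the in-degree vector of an `m`-arc-connected orientation. -/
theorem exists_balanced_inDegree [Fintype V] [Fintype E] (m : ℕ) (z : V)
    (hcut : ∀ X : Finset V, X.Nonempty → X ≠ univ → 2 * m ≤ #{e | ¬ (a e ∈ X ↔ b e ∈ X)}) :
    ∃ p : V → ℤ, (∀ v, (endDegree a b univ v : ℤ) ≤ 2 * p v + 1 ∧
        2 * p v ≤ endDegree a b univ v + 1) ∧
      (endDegree a b univ z : ℤ) ≤ 2 * p z ∧ ∑ v, p v = Fintype.card E ∧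
      ∀ X : Finset V, X.Nonempty → X ≠ univ →
        (#{e | a e ∈ X ∧ b e ∈ X} : ℤ) + m ≤ ∑ v ∈ X, p v := by
  classical
  have hall : ∑ v, endDegree a b univ v = 2 * Fintype.card E := by
    simp [sum_endDegree, card_univ]
  obtain ⟨p, h1, h2, h3, h4⟩ := exists_even_rounding
    (fun X => 2 * ((#{e | a e ∈ X ∧ b e ∈ X} : ℤ) + m)) (fun X => even_two_mul _)
    (fun X Y _ _ => by
      have : #{e | a e ∈ X ∧ b e ∈ X} + #{e | a e ∈ Y ∧ b e ∈ Y} ≤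
          #{e | a e ∈ X ∩ Y ∧ b e ∈ X ∩ Y} + #{e | a e ∈ X ∪ Y ∧ b e ∈ X ∪ Y} := by
        simp only [card_filter]
        rw [← sum_add_distrib, ← sum_add_distrib]
        refine sum_le_sum fun e _ => ?_
        simp only [mem_inter, mem_union]
        by_cases h1 : a e ∈ X <;> by_cases h2 : b e ∈ X <;> by_cases h3 : a e ∈ Y <;>
          by_cases h4 : b e ∈ Y <;> simp [h1, h2, h3, h4]
      omega)
    z _ (fun v => (endDegree a b univ v : ℤ)) rfl
    (by rw [← Nat.cast_sum, hall]; push_cast; exact even_two_mul _)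
    (fun X hX hX' => by
      rw [← Nat.cast_sum, sum_endDegree]
      have := hcut X hX hX'
      push_cast
      omega)
  refine ⟨p, h1, h2, ?_, fun X hX hX' => by have := h4 X hX hX'; omega⟩
  rw [← Nat.cast_sum, hall] at h3
  push_cast at h3
  omega

/-! ### The covering condition -/

/-- The covering condition inside one class `A`: here `X` contains the ends of all edges of `F`
outside `M`, and `ℓ v` is the number of these edges that may be assigned to `v`. -/
theorem card_inside_le [Fintype V] [Fintype E] [DecidableEq E] (m : ℕ) (z : V) (M M₀ : Finset E)
    (hMl : ∀ e ∈ M, a e ≠ b e) (hMdeg : ∀ v, endDegree a b M v ≤ m)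
    (hM₀ : #M₀ ≤ m) (p : V → ℤ) (hp : ∑ v, p v = Fintype.card E)
    (hpX : ∀ X : Finset V, X.Nonempty → X ≠ univ →
      (#{e | a e ∈ X ∧ b e ∈ X} : ℤ) + m ≤ ∑ v ∈ X, p v)
    (ℓ : V → ℕ) (hℓ : ∀ v, (ℓ v : ℤ) = p v - m + if v = z then (m : ℤ) - #M₀ else 0)
    (F : Finset E) (hF : Disjoint F M₀) (X A : Finset V) (hA : A.Nonempty)
    (hX : ∀ e ∈ F, e ∉ M → a e ∈ X ∧ b e ∈ X) :
    (#{e ∈ F | a e ∈ A ∧ b e ∈ A} : ℤ) ≤ m * (#A - 1) + ∑ v ∈ A ∩ X, (ℓ v : ℤ) := by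
  have hA1 : 1 ≤ #A := hA.card_pos
  rcases (A ∩ X).eq_empty_or_nonempty with hB | hB
  · -- all edges of `F` inside `A` belong to `M`, and `M` has at most `m * #A / 2` of them
    rw [hB, sum_empty, add_zero]
    have h1 : #{e ∈ F | a e ∈ A ∧ b e ∈ A} ≤ #{e ∈ M | a e ∈ A ∧ b e ∈ A} := by
      refine card_le_card fun e he => ?_
      simp only [mem_filter] at he ⊢
      refine ⟨?_, he.2⟩
      by_contra hcon
      have : a e ∈ A ∩ X := mem_inter.2 ⟨he.2.1, (hX e he.1 hcon).1⟩
      simp [hB] at this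
    have h2 := sum_endDegree a b M A
    have h3 : ∑ v ∈ A, endDegree a b M v ≤ #A * m := sum_le_card_nsmul _ _ _ fun v _ => hMdeg v
    rcases hA1.eq_or_lt with hA1 | hA1
    · obtain ⟨v, rfl⟩ := card_eq_one.1 hA1.symm
      have h4 : #{e ∈ M | a e ∈ ({v} : Finset V) ∧ b e ∈ ({v} : Finset V)} = 0 := by
        rw [card_eq_zero, filter_eq_empty_iff]
        intro e he h
        rw [mem_singleton, mem_singleton] at h
        exact hMl e he (h.1.trans h.2.symm)
      simp only [card_singleton, Nat.cast_one, sub_self, mul_zero]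
      omega
    · have h4 : 2 * #{e ∈ M | a e ∈ A ∧ b e ∈ A} ≤ #A * m := by omega
      zify at h1 h4 hA1
      nlinarith
  · -- an edge of `F` inside `A` either belongs to `M` and meets `A \ X`, or lies inside `A ∩ X`
    have h1 : #{e ∈ F | a e ∈ A ∧ b e ∈ A} ≤
        #{e ∈ M | a e ∈ A \ (A ∩ X) ∨ b e ∈ A \ (A ∩ X)} +
          #{e ∈ M₀ᶜ | a e ∈ A ∩ X ∧ b e ∈ A ∩ X} := by
      refine (card_le_card fun e he => ?_).trans (card_union_le _ _)
      simp only [mem_filter, mem_union, mem_sdiff, mem_inter, mem_compl] at he ⊢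
      have := hX e he.1
      have := disjoint_left.1 hF he.1
      tauto
    have h2 : #{e ∈ M | a e ∈ A \ (A ∩ X) ∨ b e ∈ A \ (A ∩ X)} ≤ #(A \ (A ∩ X)) * m :=
      (card_touching_le_sum_endDegree a b M _).trans (sum_le_card_nsmul _ _ _ fun v _ => hMdeg v)
    have h3 : #(A \ (A ∩ X)) + #(A ∩ X) = #A := card_sdiff_add_card_eq_card inter_subset_left
    have h4 : ∑ v ∈ A ∩ X, (ℓ v : ℤ) = ∑ v ∈ A ∩ X, p v - #(A ∩ X) * m +
        if z ∈ A ∩ X then (m : ℤ) - #M₀ else 0 := by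
      rw [sum_congr rfl fun v _ => hℓ v]
      simp [sum_add_distrib, sum_sub_distrib]
    have h5 : (0 : ℤ) ≤ (m : ℤ) - #M₀ := by omega
    by_cases hBu : A ∩ X = univ
    · -- here the extra capacity `m - #M₀` of `z` is what is needed
      have h6 : #{e ∈ M₀ᶜ | a e ∈ A ∩ X ∧ b e ∈ A ∩ X} + #M₀ ≤ Fintype.card E := by
        rw [← card_compl_add_card M₀]
        exact Nat.add_le_add_right (card_filter_le _ _) _
      rw [hBu] at h4
      rw [if_pos (mem_univ z), hp, ← hBu] at h4
      rw [h4]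
      zify at h1 h2 h3 h6
      nlinarith
    · have h6 : #{e ∈ M₀ᶜ | a e ∈ A ∩ X ∧ b e ∈ A ∩ X} ≤ #{e | a e ∈ A ∩ X ∧ b e ∈ A ∩ X} :=
        card_le_card (filter_subset_filter _ (subset_univ _))
      have h7 := hpX _ hB hBu
      have h8 : ∑ v ∈ A ∩ X, p v - #(A ∩ X) * m ≤ ∑ v ∈ A ∩ X, (ℓ v : ℤ) := by
        rw [h4]; split_ifs <;> linarith
      zify at h1 h2 h3 h6
      nlinarith

/-- The hypothesis of the covering theorem: `m` copies of the graphic matroid together with, for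
every vertex `v`, `ℓ v` copies of the rank-one matroid of the edges at `v` outside `M`. -/
theorem card_le_graphicRank_add [Fintype V] [Fintype E] [DecidableEq E] (m : ℕ) (z : V)
    (M M₀ : Finset E)
    (hMl : ∀ e ∈ M, a e ≠ b e) (hMdeg : ∀ v, endDegree a b M v ≤ m)
    (hM₀ : #M₀ ≤ m) (p : V → ℤ) (hp : ∑ v, p v = Fintype.card E)
    (hpX : ∀ X : Finset V, X.Nonempty → X ≠ univ →
      (#{e | a e ∈ X ∧ b e ∈ X} : ℤ) + m ≤ ∑ v ∈ X, p v)
    (ℓ : V → ℕ) (hℓ : ∀ v, (ℓ v : ℤ) = p v - m + if v = z then (m : ℤ) - #M₀ else 0)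
    (F : Finset E) (hF : Disjoint F M₀) :
    #F ≤ m * graphicRank a b F +
      ∑ v, ℓ v * if ∃ e ∈ F, e ∉ M ∧ (a e = v ∨ b e = v) then 1 else 0 := by
  obtain ⟨c, hc, hcard⟩ := exists_classes a b F
  let X : Finset V := {v | ∃ e ∈ F, e ∉ M ∧ (a e = v ∨ b e = v)}
  have hX : ∀ e ∈ F, e ∉ M → a e ∈ X ∧ b e ∈ X := fun e he heM => by
    simp only [X, mem_filter, mem_univ, true_and]
    exact ⟨⟨e, he, heM, Or.inl rfl⟩, ⟨e, he, heM, Or.inr rfl⟩⟩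
  let A : V → Finset V := fun k => {v | c v = k}
  have h1 : (#F : ℤ) = ∑ k ∈ univ.image c, (#{e ∈ F | a e ∈ A k ∧ b e ∈ A k} : ℤ) := by
    rw [card_eq_sum_card_fiberwise (f := fun e => c (a e)) (t := univ.image c)
      (fun e _ => mem_coe.2 (mem_image_of_mem _ (mem_univ _)))]
    push_cast
    refine sum_congr rfl fun k _ => ?_
    congr 2
    refine filter_congr fun e he => ?_
    simp [A, ← hc e he]
  have h2 : ∑ k ∈ univ.image c, (#{e ∈ F | a e ∈ A k ∧ b e ∈ A k} : ℤ) ≤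
      ∑ k ∈ univ.image c, ((m : ℤ) * (#(A k) - 1) + ∑ v ∈ A k ∩ X, (ℓ v : ℤ)) := by
    refine sum_le_sum fun k hk => ?_
    refine card_inside_le a b m z M M₀ hMl hMdeg hM₀ p hp hpX ℓ hℓ F hF X (A k) ?_ hX
    obtain ⟨v, _, rfl⟩ := mem_image.1 hk
    exact ⟨v, by simp [A]⟩
  have h3 : ∑ k ∈ univ.image c, (#(A k) : ℤ) = Fintype.card V := by
    rw [← card_univ, card_eq_sum_card_image c]
    push_cast
    rfl
  have h4 : ∑ k ∈ univ.image c, ∑ v ∈ A k ∩ X, (ℓ v : ℤ) = ∑ v ∈ X, (ℓ v : ℤ) := by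
    rw [← sum_fiberwise_of_maps_to (s := X) (t := univ.image c) (g := c)
      (fun v _ => mem_image_of_mem _ (mem_univ _))]
    refine sum_congr rfl fun k _ => sum_congr ?_ fun _ _ => rfl
    ext v; simp [A, and_comm]
  have h5 : ∑ v, ℓ v * (if ∃ e ∈ F, e ∉ M ∧ (a e = v ∨ b e = v) then 1 else 0) =
      ∑ v ∈ X, ℓ v := by
    simp only [mul_ite, mul_one, mul_zero, X, sum_filter]
  rw [h5]
  rw [sum_add_distrib, ← mul_sum, sum_sub_distrib, h3, h4] at h2
  simp only [sum_const, nsmul_eq_mul, mul_one] at h2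
  zify at hcard ⊢
  rw [h1]
  nlinarith

end endDegree

/-! ### Spanning trees together with an oriented remainder -/

theorem exists_indicator_mono {E : Type*} (P : E → Prop) [DecidablePred P]
    {S T : Finset E} (hST : S ⊆ T) :
    (if ∃ e ∈ S, P e then 1 else 0) ≤ if ∃ e ∈ T, P e then 1 else 0 := by
  split_ifs with h1 h2
  · exact le_rfl
  · exact absurd (h1.imp fun e he => ⟨hST he.1, he.2⟩) h2
  · exact Nat.zero_le _
  · exact le_rfl

/-- The rank function of a matroid of rank at most one is submodular. -/
theorem exists_indicator_submodular {E : Type*} [DecidableEq E] (P : E → Prop)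
    [DecidablePred P] (S T : Finset E) :
    (if ∃ e ∈ S ∪ T, P e then 1 else 0) + (if ∃ e ∈ S ∩ T, P e then 1 else 0) ≤
      (if ∃ e ∈ S, P e then 1 else 0) + if ∃ e ∈ T, P e then 1 else 0 := by
  have h1 : (∃ e ∈ S ∪ T, P e) ↔ (∃ e ∈ S, P e) ∨ ∃ e ∈ T, P e := by
    simp only [mem_union, or_and_right, exists_or]
  have h2 := exists_indicator_mono P (inter_subset_left : S ∩ T ⊆ S)
  have h3 := exists_indicator_mono P (inter_subset_right : S ∩ T ⊆ T)
  rw [if_congr h1 rfl rfl]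
  by_cases h4 : ∃ e ∈ S, P e
  · rw [if_pos (Or.inl h4), if_pos h4]
    omega
  · rw [if_neg h4] at h2 ⊢
    by_cases h5 : ∃ e ∈ T, P e
    · rw [if_pos (Or.inr h5), if_pos h5]
      omega
    · rw [if_neg h5, if_neg (not_or.2 ⟨h4, h5⟩)]
      omega

section decomposition

variable {V E : Type*} [Fintype V] [DecidableEq V] (a b : E → V)

theorem endDegree_pos_of_spanning {T : Finset E} (hT : Fintype.card V ≤ graphicRank a b T + 1)
    {v w : V} (hvw : w ≠ v) : 1 ≤ endDegree a b T v := by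
  have : Nonempty V := ⟨v⟩
  by_contra hcon
  have h0 : endCount a T v = 0 ∧ endCount b T v = 0 := by unfold endDegree at hcon; omega
  simp only [endCount, card_eq_zero, filter_eq_empty_iff] at h0
  exact hvw (mem_of_graphicRank_add_one_eq_card a b hT {v}
    (fun e he => by simp [h0.1 he, h0.2 he]) (Set.mem_singleton v) w)

variable [Fintype E] [DecidableEq E]

/-- The covering theorem applied to the edges outside `M₀`: label `inl i` stands for the `i`-th
forest, and the labels `inr ⟨v, j⟩` for the edges outside `M` whose head is `v`. -/
theorem exists_edge_assignment (m : ℕ) (hm : 0 < m) (M M₀ : Finset E) (ℓ : V → ℕ)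
    (hcov : ∀ F : Finset E, Disjoint F M₀ → #F ≤ m * graphicRank a b F +
      ∑ v, ℓ v * if ∃ e ∈ F, e ∉ M ∧ (a e = v ∨ b e = v) then 1 else 0) :
    ∃ c : E → Fin m ⊕ (Σ v, Fin (ℓ v)),
      (∀ i, ∀ F ⊆ M₀ᶜ, (∀ e ∈ F, c e = Sum.inl i) → #F ≤ graphicRank a b F) ∧
      ∀ x, ∀ F ⊆ M₀ᶜ, (∀ e ∈ F, c e = Sum.inr x) →
        #F ≤ if ∃ e ∈ F, e ∉ M ∧ (a e = x.1 ∨ b e = x.1) then 1 else 0 := by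
  let r : Fin m ⊕ (Σ v, Fin (ℓ v)) → Finset E → ℕ :=
    Sum.elim (fun _ => graphicRank a b)
      (fun x F => if ∃ e ∈ F, e ∉ M ∧ (a e = x.1 ∨ b e = x.1) then 1 else 0)
  have : Nonempty (Fin m ⊕ (Σ v, Fin (ℓ v))) := ⟨Sum.inl ⟨0, hm⟩⟩
  obtain ⟨c, hc⟩ := exists_cover_of_card_le_sum r
    (by rintro (i | x) <;> simp [r, graphicRank_empty])
    (by
      rintro (i | x) S T hST
      · exact graphicRank_mono a b hST
      · exact exists_indicator_mono _ hST)
    (by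
      rintro (i | x) S T
      · exact graphicRank_submodular a b S T
      · exact exists_indicator_submodular _ S T)
    M₀ᶜ
    (fun F hF => by
      refine (hcov F (disjoint_left.2 fun e he => mem_compl.1 (hF he))).trans_eq ?_
      simp only [r, Fintype.sum_sum_type, Sum.elim_inl, Sum.elim_inr, Fintype.sum_sigma, sum_const,
        card_univ, Fintype.card_fin, smul_eq_mul]
      exact congrArg _ (sum_congr rfl fun v _ =>
        (by simp : ∀ n k : ℕ, n * k = ∑ _j : Fin n, k) _ _))
  exact ⟨c, fun i => hc (Sum.inl i), fun x => hc (Sum.inr x)⟩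

/-- The edges outside `M₀` split into `m` spanning trees, which cover `M`, and a set `R` with an
orientation (heads `h`, tails `t`) of prescribed in-degrees `ℓ`. -/
theorem exists_trees_and_oriented_remainder [Nonempty V] (m : ℕ) (hm : 0 < m) (M M₀ : Finset E)
    (ℓ : V → ℕ)
    (hℓ : ∑ v, ℓ v + m * (Fintype.card V - 1) + #M₀ = Fintype.card E)
    (hcov : ∀ F : Finset E, Disjoint F M₀ → #F ≤ m * graphicRank a b F +
      ∑ v, ℓ v * if ∃ e ∈ F, e ∉ M ∧ (a e = v ∨ b e = v) then 1 else 0) :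
    ∃ (T : Fin m → Finset E) (R : Finset E) (h t : E → V),
      (∀ i, #(T i) ≤ graphicRank a b (T i)) ∧
      (∀ i, Fintype.card V ≤ graphicRank a b (T i) + 1) ∧
      (∀ i j, i ≠ j → Disjoint (T i) (T j)) ∧
      (∀ i, Disjoint (T i) M₀) ∧ (∀ i, Disjoint (T i) R) ∧ Disjoint R M₀ ∧ Disjoint M R ∧
      (∀ e, a e = b e → e ∉ M₀ → e ∈ R) ∧
      (∀ e ∈ R, (h e = a e ∧ t e = b e) ∨ (h e = b e ∧ t e = a e)) ∧
      ∀ v, endCount h R v = ℓ v := by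
  obtain ⟨c, hcl, hcr⟩ := exists_edge_assignment a b m hm M M₀ ℓ hcov
  let T : Fin m → Finset E := fun i => {e ∈ M₀ᶜ | c e = Sum.inl i}
  let R : Finset E := {e ∈ M₀ᶜ | (c e).isRight}
  let h : E → V := fun e => Sum.elim (fun _ => a e) (fun x => x.1) (c e)
  let t : E → V := fun e => if h e = a e then b e else a e
  have hTle : ∀ i, #(T i) ≤ graphicRank a b (T i) := fun i =>
    hcl i (T i) (filter_subset _ _) fun e he => (mem_filter.1 he).2
  have hR : ∀ e ∈ R, ∃ x, c e = Sum.inr x ∧ e ∉ M ∧ (a e = x.1 ∨ b e = x.1) := by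
    intro e he
    obtain ⟨he1, he2⟩ := mem_filter.1 he
    obtain ⟨x, hx⟩ := Sum.isRight_iff.1 he2
    have := hcr x {e} (singleton_subset_iff.2 he1) (by simpa)
    refine ⟨x, hx, ?_⟩
    by_contra hcon
    simp [hcon] at this
  have hh : ∀ e x, c e = Sum.inr x → h e = x.1 := fun e x hx => by simp [h, hx]
  have hin : ∀ v, endCount h R v ≤ ℓ v := by
    intro v
    have h1 : #{e ∈ R | h e = v} ≤
        #((univ : Finset (Fin (ℓ v))).image fun j =>
          (Sum.inr ⟨v, j⟩ : Fin m ⊕ (Σ v, Fin (ℓ v)))) := by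
      refine card_le_card_of_injOn c ?_ ?_
      · intro e he
        obtain ⟨he1, he2⟩ := mem_filter.1 (mem_coe.1 he)
        obtain ⟨⟨w, j⟩, hx, -⟩ := hR e he1
        have := hh e _ hx
        rw [he2] at this
        subst this
        simp [hx]
      · intro e he e' he' hee
        obtain ⟨he1, -⟩ := mem_filter.1 (mem_coe.1 he)
        obtain ⟨he1', -⟩ := mem_filter.1 (mem_coe.1 he')
        obtain ⟨x, hx, -⟩ := hR e he1
        have h2 := hcr x {e, e'} (by
          intro y hy
          rcases mem_insert.1 hy with rfl | hy
          · exact (mem_filter.1 he1).1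
          · rw [mem_singleton.1 hy]; exact (mem_filter.1 he1').1)
          (by simp [hx, ← hee])
        by_contra hne
        rw [card_pair hne] at h2
        split_ifs at h2 <;> omega
    exact h1.trans (card_image_le.trans_eq (card_fin _))
  have hcount : #(M₀ᶜ) = ∑ i, #(T i) + #R := by
    have h1 : #R = #{e ∈ M₀ᶜ | ¬ ∃ i, c e = Sum.inl i} := by
      congr 1
      refine filter_congr fun e _ => ?_
      rcases c e with i | x <;> simp
    have h2 : #{e ∈ M₀ᶜ | ∃ i, c e = Sum.inl i} = ∑ i, #(T i) := by
      rw [← card_biUnion]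
      · congr 1
        ext e; simp [T]
      · intro i _ j _ hij
        rw [Function.onFun, disjoint_left]
        intro e he he'
        have h3 := (mem_filter.1 he).2
        rw [(mem_filter.1 he').2] at h3
        exact hij (Sum.inl_injective h3).symm
    rw [h1, ← h2, card_filter_add_card_filter_not]
  have hRsum : ∑ v, endCount h R v = #R := by rw [sum_endCount]; simp
  have hcompl : #(M₀ᶜ) + #M₀ = Fintype.card E := card_compl_add_card M₀
  have hn : 0 < Fintype.card V := Fintype.card_pos
  have hTn : ∀ i, #(T i) ≤ Fintype.card V - 1 := fun i => by
    have := hTle i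
    have := graphicRank_lt_card a b (T i)
    omega
  have hTsum : ∑ i, #(T i) ≤ ∑ _i : Fin m, (Fintype.card V - 1) := sum_le_sum fun i _ => hTn i
  have hRle := sum_le_sum fun v (_ : v ∈ univ) => hin v
  -- both estimates are sharp, since they add up to the number of all edges outside `M₀`
  have hTeq : ∀ i, #(T i) = Fintype.card V - 1 := fun i =>
    (sum_eq_sum_iff_of_le fun i _ => hTn i).1
      (by simp only [sum_const, card_univ, Fintype.card_fin, smul_eq_mul] at hTsum ⊢; omega)
      i (mem_univ _)
  have hReq : ∀ v, endCount h R v = ℓ v := fun v =>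
    (sum_eq_sum_iff_of_le fun v _ => hin v).1
      (by simp only [sum_const, card_univ, Fintype.card_fin, smul_eq_mul] at hTsum; omega)
      v (mem_univ _)
  refine ⟨T, R, h, t, hTle, fun i => ?_, fun i j hij => ?_, fun i => ?_, fun i => ?_, ?_, ?_,
    fun e he heM => ?_, fun e he => ?_, hReq⟩
  · have := hTle i
    have := hTeq i
    omega
  · rw [disjoint_left]
    intro e he he'
    have h3 := (mem_filter.1 he).2
    rw [(mem_filter.1 he').2] at h3
    exact hij (Sum.inl_injective h3).symm
  · exact disjoint_left.2 fun e he => mem_compl.1 (mem_filter.1 he).1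
  · rw [disjoint_left]
    intro e he he'
    obtain ⟨x, hx, -⟩ := hR e he'
    have h3 := (mem_filter.1 he).2
    simp [hx] at h3
  · exact disjoint_left.2 fun e he => mem_compl.1 (mem_filter.1 he).1
  · rw [disjoint_left]
    intro e he he'
    obtain ⟨x, -, hx, -⟩ := hR e he'
    exact hx he
  · refine mem_filter.2 ⟨mem_compl.2 heM, ?_⟩
    rcases hi : c e with i | x
    · have := hcl i {e} (singleton_subset_iff.2 (mem_compl.2 heM)) (by simpa)
      simp [graphicRank_singleton_of_loop a b he] at this
    · rfl
  · obtain ⟨x, hx, -, hx'⟩ := hR e he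
    have h1 := hh e x hx
    by_cases h2 : h e = a e
    · exact Or.inl ⟨h2, by simp [t, h2]⟩
    · refine Or.inr ⟨?_, by simp [t, h2]⟩
      rw [h1] at h2 ⊢
      rcases hx' with hx' | hx'
      · exact absurd hx'.symm h2
      · exact hx'.symm

/-- The theorem for a multigraph given by its finite types of vertices and edges and the ends `a`,
`b` of the edges, with spanning trees described by the graphic rank. -/
theorem exists_trees_and_complement (m : ℕ) (hm : 0 < m) (z : V)
    (M M₀ : Finset E)
    (hcut : ∀ X : Finset V, X.Nonempty → X ≠ univ → 2 * m ≤ #{e | ¬ (a e ∈ X ↔ b e ∈ X)})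
    (hMl : ∀ e ∈ M, a e ≠ b e) (hM₀l : ∀ e ∈ M₀, a e ≠ b e) (hdisj : Disjoint M M₀)
    (hMdeg : ∀ v, endDegree a b M v ≤ m) (hM₀card : #M₀ ≤ m)
    (hM₀deg : ∀ v, v ≠ z → endDegree a b M₀ v < m)
    (hloop : endDegree a b M₀ z = m → Even (endDegree a b univ z) →
      Even #{e | a e = z ∧ b e = z}) :
    ∃ (T : Fin m → Finset E) (H : Finset E),
      (∀ i, #(T i) ≤ graphicRank a b (T i)) ∧
      (∀ i, Fintype.card V ≤ graphicRank a b (T i) + 1) ∧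
      (∀ i j, i ≠ j → Disjoint (T i) (T j)) ∧ (∀ i, T i ⊆ H) ∧ M ⊆ H ∧ Disjoint H M₀ ∧
      (∀ v, endDegree a b univ v / 2 ≤ endDegree a b H v ∧
        endDegree a b H v + endDegree a b M₀ v ≤ (endDegree a b univ v + 1) / 2 + m) ∧
      endDegree a b H z + endDegree a b M₀ z ≤ endDegree a b univ z / 2 + max 1 #M₀ := by
  have : Nonempty V := ⟨z⟩
  obtain ⟨p, hp, hpz, hpE, hpX⟩ := exists_balanced_inDegree a b m z hcut
  -- with a single vertex there are no edges in `M₀`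
  have hM₀ne : ∀ v : V, 0 < #M₀ → ∃ w, w ≠ v := by
    intro v hpos
    obtain ⟨e, he⟩ := card_pos.1 hpos
    by_contra! hcon
    exact hM₀l e he ((hcon _).trans (hcon _).symm)
  have hpm : ∀ v w, w ≠ v → (m : ℤ) ≤ p v := by
    intro v w hw
    have := hpX {v} (singleton_nonempty v) (fun h => hw (by
      have : w ∈ ({v} : Finset V) := by rw [h]; exact mem_univ w
      exact mem_singleton.1 this))
    rw [sum_singleton] at this
    omega
  have hℓ : ∀ v, ∃ l : ℕ, (l : ℤ) = p v - m + if v = z then (m : ℤ) - #M₀ else 0 := by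
    intro v
    refine ⟨(p v - m + if v = z then (m : ℤ) - #M₀ else 0).toNat, Int.toNat_of_nonneg ?_⟩
    split_ifs with h
    · subst h
      rcases Nat.eq_zero_or_pos #M₀ with h0 | h0
      · have := hp v
        omega
      · obtain ⟨w, hw⟩ := hM₀ne v h0
        have := hpm v w hw
        omega
    · have := hpm v z (Ne.symm h)
      omega
  choose ℓ hℓ using hℓ
  have hn : 0 < Fintype.card V := Fintype.card_pos
  have hℓsum : ∑ v, ℓ v + m * (Fintype.card V - 1) + #M₀ = Fintype.card E := by
    have h1 : (∑ v, ℓ v : ℤ) = Fintype.card E - Fintype.card V * m + (m - #M₀) := by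
      rw [sum_congr rfl fun v _ => hℓ v]
      simp [sum_add_distrib, sum_sub_distrib, hpE]
    zify [Nat.one_le_iff_ne_zero.2 hn.ne']
    rw [h1]
    ring
  obtain ⟨T, R, h, t, hT1, hT2, hT3, hTM₀, hTR, hRM₀, hMR, hRloop, hends, hin⟩ :=
    exists_trees_and_oriented_remainder a b m hm M M₀ ℓ hℓsum
      (card_le_graphicRank_add a b m z M M₀ hMl hMdeg hM₀card p hpE hpX ℓ hℓ)
  -- degrees in the remainder do not depend on its orientation
  have hdeg : ∀ C ⊆ R, ∀ v, endCount h C v + endCount t C v = endDegree a b C v := by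
    intro C hC v
    simp only [endDegree, endCount, card_filter, ← sum_add_distrib]
    refine sum_congr rfl fun e he => ?_
    rcases hends e (hC he) with ⟨h1, h2⟩ | ⟨h1, h2⟩
    · rw [h1, h2]
    · rw [h1, h2, add_comm]
  set B : Finset E := M₀ᶜ \ R with hB
  have hRsub : R ⊆ M₀ᶜ := fun e he => mem_compl.2 (disjoint_left.1 hRM₀ he)
  have htot : ∀ v, endDegree a b B v + endDegree a b R v + endDegree a b M₀ v =
      endDegree a b univ v := by
    intro v
    rw [hB, endDegree_sdiff a b hRsub, compl_eq_univ_sdiff, endDegree_sdiff a b (subset_univ _)]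
  have hTB : ∀ i, T i ⊆ B := fun i e he => mem_sdiff.2
    ⟨mem_compl.2 (disjoint_left.1 (hTM₀ i) he), disjoint_left.1 (hTR i) he⟩
  have hBdeg : ∀ v w, w ≠ v → m ≤ endDegree a b B v := by
    intro v w hw
    have h1 : ∀ s : E → V, ∑ i, endCount s (T i) v ≤ endCount s B v := by
      intro s
      unfold endCount
      rw [← card_biUnion fun i _ j _ hij => disjoint_filter_filter (hT3 i j hij)]
      refine card_le_card (biUnion_subset.2 fun i _ => filter_subset_filter _ (hTB i))
    calc m = ∑ _i : Fin m, 1 := by simp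
      _ ≤ ∑ i, endDegree a b (T i) v :=
        sum_le_sum fun i _ => endDegree_pos_of_spanning a b (hT2 i) hw
      _ ≤ endDegree a b B v := by
        simp only [endDegree, sum_add_distrib]
        exact add_le_add (h1 a) (h1 b)
  have hBM₀ : ∀ v, #M₀ ≤ endDegree a b B v := by
    intro v
    rcases Nat.eq_zero_or_pos #M₀ with h0 | h0
    · omega
    · obtain ⟨w, hw⟩ := hM₀ne v h0
      exact hM₀card.trans (hBdeg v w hw)
  have hM₀z := endDegree_le_card_of_loopless a b hM₀l z
  obtain ⟨C, hCR, hC⟩ := exists_subset_degree_between h t z R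
    (fun v => if v = z then (endDegree a b univ v + 1 : ℤ) / 2 - max 1 #M₀
      else (endDegree a b univ v : ℤ) / 2 - m)
    (fun v => (endDegree a b univ v + 1 : ℤ) / 2 - endDegree a b M₀ v)
    (fun v => by
      have h1 := hℓ v
      have h2 := hp v
      simp only [hin]
      split_ifs at h1 ⊢ with hv
      · subst hv; omega
      · omega)
    (fun v => by
      have h1 := hℓ v
      have h2 := hp v
      have h3 := hdeg R Subset.rfl v
      have h4 := htot v
      have h5 := hBM₀ v
      rw [hin] at h3
      split_ifs at h1 with hv
      · omega
      · have := hBdeg v z (Ne.symm hv)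
        omega)
    (fun v => by
      split_ifs with hv
      · subst hv; omega
      · have := hM₀deg v hv
        omega)
    (fun v hv => by
      have := hM₀deg v hv
      rw [if_neg hv]
      omega)
    (fun hzz => by
      -- the interval at `z` is a point only if all edges of `M₀` are incident with `z`
      rw [if_pos rfl] at hzz
      have hM₀eq : endDegree a b M₀ z = #M₀ ∧ 0 < #M₀ := by omega
      have h1 := hℓ z
      rw [if_pos rfl] at h1
      have h2 := hp z
      have h3 := hdeg R Subset.rfl z
      have h4 := htot z
      rw [hin] at h3
      obtain ⟨w, hw⟩ := hM₀ne z hM₀eq.2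
      have h5 := hBdeg z w hw
      by_cases h6 : #M₀ = m ∧ Even (endDegree a b univ z)
      · left
        convert hloop (hM₀eq.1.trans h6.1) h6.2 using 2
        ext e
        simp only [mem_filter, mem_univ, true_and]
        constructor
        · rintro ⟨he, h7, h8⟩
          rcases hends e he with ⟨h9, h10⟩ | ⟨h9, h10⟩
          · exact ⟨h9 ▸ h7, h10 ▸ h8⟩
          · exact ⟨h10 ▸ h8, h9 ▸ h7⟩
        · rintro ⟨h7, h8⟩
          have he : e ∈ R := hRloop e (h7.trans h8.symm) fun he => hM₀l e he (h7.trans h8.symm)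
          rcases hends e he with ⟨h9, h10⟩ | ⟨h9, h10⟩
          · exact ⟨he, h9 ▸ h7, h10 ▸ h8⟩
          · exact ⟨he, h9 ▸ h8, h10 ▸ h7⟩
      · right
        by_cases h7 : #M₀ = m
        · have h8 := mt (And.intro h7) h6
          rw [Nat.not_even_iff_odd] at h8
          obtain ⟨k, hk⟩ := h8
          omega
        · omega)
  refine ⟨T, M₀ᶜ \ C, hT1, hT2, hT3, fun i => (hTB i).trans (sdiff_subset_sdiff Subset.rfl hCR),
    fun e he => mem_sdiff.2 ⟨mem_compl.2 (disjoint_left.1 hdisj he),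
      fun heC => disjoint_left.1 hMR he (hCR heC)⟩,
    disjoint_left.2 fun e he => mem_compl.1 (mem_sdiff.1 he).1, ?_⟩
  have hH : ∀ v, endDegree a b (M₀ᶜ \ C) v + endDegree a b C v + endDegree a b M₀ v =
      endDegree a b univ v := by
    intro v
    rw [endDegree_sdiff a b (hCR.trans hRsub), compl_eq_univ_sdiff,
      endDegree_sdiff a b (subset_univ _)]
  refine ⟨fun v => ?_, ?_⟩
  · have h1 := hC v
    have h2 := hH v
    have h3 := hdeg C hCR v
    split_ifs at h1 with hv
    · subst hv
      have : max 1 #M₀ ≤ m := by omega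
      omega
    · omega
  · have h1 := hC z
    have h2 := hH z
    have h3 := hdeg C hCR z
    rw [if_pos rfl] at h1
    omega

end decomposition

/-! ### Transfer to `Graph` -/

namespace Graph

variable {α β : Type*} {G : Graph α β} {a b : G.edgeSet → G.vertexSet}

theorem exists_ends (G : Graph α β) : ∃ a b : G.edgeSet → G.vertexSet,
    ∀ e : G.edgeSet, G.IsLink e (a e) (b e) := by
  choose a b h using fun e : G.edgeSet => G.exists_isLink_of_mem_edgeSet e.2
  exact ⟨fun e => ⟨a e, (h e).left_mem⟩, fun e => ⟨b e, (h e).right_mem⟩, h⟩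

/-- Translates cardinalities of sets of edges into those of finite sets over the subtype of
edges. -/
theorem ncard_eq_card_filter [Fintype G.edgeSet] (S : Set β) (p : G.edgeSet → Prop)
    [DecidablePred p] (F : Finset G.edgeSet) (hS : ∀ e ∈ S, e ∈ G.edgeSet)
    (h : ∀ e : G.edgeSet, (e : β) ∈ S ↔ e ∈ F ∧ p e) : S.ncard = #{e ∈ F | p e} := by
  have : S = Subtype.val '' (({e ∈ F | p e} : Finset G.edgeSet) : Set G.edgeSet) := by
    ext e
    simp only [Set.mem_image, mem_coe, mem_filter]
    constructor
    · exact fun he => ⟨⟨e, hS e he⟩, (h ⟨e, hS e he⟩).1 he, rfl⟩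
    · rintro ⟨e, he, rfl⟩
      exact (h e).2 he
  rw [this, Set.ncard_image_of_injective _ Subtype.val_injective, Set.ncard_coe_finset]

theorem isLink_iff_of_ends (hab : ∀ e : G.edgeSet, G.IsLink e (a e) (b e)) {H : Graph α β}
    (hH : H ≤ G) (e : G.edgeSet) (x y : G.vertexSet) :
    H.IsLink e x y ↔ (e : β) ∈ H.edgeSet ∧ ((a e = x ∧ b e = y) ∨ (a e = y ∧ b e = x)) := by
  have h1 : G.IsLink e x y ↔ (a e = x ∧ b e = y) ∨ (a e = y ∧ b e = x) := by
    rw [(hab e).isLink_iff, Subtype.coe_inj, Subtype.coe_inj, Subtype.coe_inj, Subtype.coe_inj]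
  rw [← h1]
  refine ⟨fun h => ⟨h.edge_mem, h.mono hH⟩, fun h => ?_⟩
  obtain ⟨u, w, h2⟩ := H.exists_isLink_of_mem_edgeSet h.1
  rcases (h2.mono hH).eq_and_eq_or_eq_and_eq h.2 with ⟨h3, h4⟩ | ⟨h3, h4⟩
  · rwa [h3, h4] at h2
  · rw [h3, h4] at h2
    exact h2.symm

theorem degree_eq_endDegree [DecidableEq G.vertexSet] [Fintype G.edgeSet]
    (hab : ∀ e : G.edgeSet, G.IsLink e (a e) (b e)) {H : Graph α β} (hH : H ≤ G)
    (F : Finset G.edgeSet) (hF : ∀ e : G.edgeSet, e ∈ F ↔ (e : β) ∈ H.edgeSet) (v : G.vertexSet) :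
    H.degree v = endDegree a b F v := by
  have hHE : ∀ e ∈ H.edgeSet, e ∈ G.edgeSet := fun e he => by
    obtain ⟨u, w, h⟩ := H.exists_isLink_of_mem_edgeSet he
    exact (h.mono hH).edge_mem
  have h1 : (H.incidenceSet v).ncard = #{e ∈ F | a e = v ∨ b e = v} := by
    refine ncard_eq_card_filter _ _ F (fun e he => hHE e (Inc.edge_mem he)) fun e => ?_
    rw [hF, mem_incidenceSet]
    constructor
    · rintro ⟨y, hy⟩
      have hyG := (hy.mono hH).right_mem
      have := (isLink_iff_of_ends hab hH e v ⟨y, hyG⟩).1 hy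
      tauto
    · rintro ⟨he, h | h⟩
      · exact ⟨b e, (isLink_iff_of_ends hab hH e v (b e)).2 ⟨he, Or.inl ⟨h, rfl⟩⟩⟩
      · exact ⟨a e, (isLink_iff_of_ends hab hH e v (a e)).2 ⟨he, Or.inr ⟨rfl, h⟩⟩⟩
  have h2 : (H.loopSet v).ncard = #{e ∈ F | a e = v ∧ b e = v} := by
    refine ncard_eq_card_filter _ _ F (fun e he => hHE e (IsLoopAt.edge_mem he)) fun e => ?_
    rw [hF, mem_loopSet, IsLoopAt, isLink_iff_of_ends hab hH]
    tauto
  rw [degree, h1, h2, endDegree, endCount, endCount]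
  simp only [card_filter, ← sum_add_distrib]
  refine sum_congr rfl fun e _ => ?_
  by_cases h3 : a e = v <;> by_cases h4 : b e = v <;> simp [h3, h4]

theorem ncard_edgeCut [DecidableEq G.vertexSet] [Fintype G.edgeSet]
    (hab : ∀ e : G.edgeSet, G.IsLink e (a e) (b e)) (X : Finset G.vertexSet) :
    (G.edgeCut (Subtype.val '' (X : Set G.vertexSet))).ncard = #{e | ¬ (a e ∈ X ↔ b e ∈ X)} := by
  have hmem : ∀ x : G.vertexSet, (x : α) ∈ Subtype.val '' (X : Set G.vertexSet) ↔ x ∈ X := by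
    simp
  refine ncard_eq_card_filter _ _ univ ?_ fun e => ?_
  · rintro e ⟨x, y, h, -⟩
    exact h.edge_mem
  · simp only [mem_univ, true_and]
    constructor
    · rintro ⟨x, y, h, hx, hy⟩
      have h1 := (isLink_iff_of_ends hab le_rfl e ⟨x, h.left_mem⟩ ⟨y, h.right_mem⟩).1 h
      have h2 := (hmem ⟨x, h.left_mem⟩).1 hx
      have h3 := mt (hmem ⟨y, h.right_mem⟩).2 hy
      rcases h1.2 with ⟨h4, h5⟩ | ⟨h4, h5⟩ <;> rw [h4, h5] <;> tauto
    · intro h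
      by_cases h1 : a e ∈ X
      · exact ⟨a e, b e, hab e, (hmem _).2 h1, mt (hmem _).1 (by tauto)⟩
      · exact ⟨b e, a e, (hab e).symm, (hmem _).2 (by tauto), mt (hmem _).1 h1⟩

/-- A set of `|V| - 1` edges which is independent in the graphic matroid is a spanning tree. -/
theorem isTree_restrict [Fintype G.vertexSet] [DecidableEq G.vertexSet] [Nonempty G.vertexSet]
    [DecidableEq G.edgeSet]
    (hab : ∀ e : G.edgeSet, G.IsLink e (a e) (b e)) (F : Finset G.edgeSet)
    (hF : #F ≤ graphicRank a b F) (hV : Fintype.card G.vertexSet ≤ graphicRank a b F + 1) :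
    (G.restrict (Subtype.val '' (F : Set G.edgeSet))).IsTree where
  nonempty := Set.nonempty_coe_sort.1 ‹_›
  reachable x hx y hy := by
    let A : Set G.vertexSet :=
      {w | (G.restrict (Subtype.val '' (F : Set G.edgeSet))).Reachable x w}
    have hadj : ∀ e ∈ F, (G.restrict (Subtype.val '' (F : Set G.edgeSet))).Adj (a e) (b e) :=
      fun e he => ⟨e, ⟨e, he, rfl⟩, hab e⟩
    exact mem_of_graphicRank_add_one_eq_card a b hV A
      (fun e he => ⟨fun h => Relation.ReflTransGen.tail h (hadj e he),
        fun h => Relation.ReflTransGen.tail h (hadj e he).symm⟩)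
      (x := ⟨x, hx⟩) Relation.ReflTransGen.refl ⟨y, hy⟩
  acyclic := by
    rintro _ x y ⟨⟨e, he, rfl⟩, hxy⟩ hreach
    -- the vectors along a walk avoiding `e` add up to the vector of the edge `e`
    have hspan : ∀ w (hw : w ∈ G.vertexSet), Relation.ReflTransGen
        ((G.restrict (Subtype.val '' (F : Set G.edgeSet))).deleteEdges {(e : β)}).Adj x w →
        (Pi.single ⟨x, hxy.left_mem⟩ 1 - Pi.single ⟨w, hw⟩ 1 : G.vertexSet → ℚ) ∈
          edgeSpan a b (F.erase e) := by
      intro w hw h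
      induction h with
      | refl => simp
      | @tail u w _ huw ih =>
        obtain ⟨f, hf⟩ := huw
        rw [deleteEdges_isLink, restrict_isLink] at hf
        obtain ⟨⟨⟨f, hfF, rfl⟩, hfl⟩, hfe⟩ := hf
        have hmem : f ∈ F.erase e := mem_erase.2 ⟨fun h => hfe (by rw [h]; rfl), hfF⟩
        have h1 := edgeVec_mem_edgeSpan a b hmem
        have h2 := ih hfl.left_mem
        have h3 := (isLink_iff_of_ends hab le_rfl f ⟨u, hfl.left_mem⟩ ⟨w, hw⟩).1 hfl
        rw [edgeVec] at h1
        rcases h3.2 with ⟨h4, h5⟩ | ⟨h4, h5⟩ <;> rw [h4, h5] at h1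
        · simpa using Submodule.add_mem _ h2 h1
        · simpa using Submodule.sub_mem _ h2 h1
    have h1 := hspan y hxy.right_mem hreach
    refine edgeVec_notMem_edgeSpan_erase a b hF he ?_
    have h3 := (isLink_iff_of_ends hab le_rfl e ⟨x, hxy.left_mem⟩ ⟨y, hxy.right_mem⟩).1 hxy
    rw [edgeVec]
    rcases h3.2 with ⟨h4, h5⟩ | ⟨h4, h5⟩ <;> rw [h4, h5]
    · exact h1
    · simpa using Submodule.neg_mem _ h1

end Graph

/-- A factor of `G` is a spanning subgraph of `G`. For a natural number `d`, `d / 2` is the floor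
and `(d + 1) / 2` the ceiling of half of `d`. -/
theorem mainTheorem11 {α β : Type*} (G : Graph α β)
    (hV : G.vertexSet.Finite) (hE : G.edgeSet.Finite)
    (m : ℕ) (hm : 0 < m) (hG : G.EdgeConnected (2 * m))
    (z : α) (hz : z ∈ G.vertexSet)
    (M M₀ : Graph α β) (hM : M.IsSpanningSubgraph G) (hM₀ : M₀.IsSpanningSubgraph G)
    (hMl : M.Loopless) (hM₀l : M₀.Loopless) (hdisj : Disjoint M.edgeSet M₀.edgeSet)
    (hMdeg : ∀ v ∈ G.vertexSet, M.degree v ≤ m)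
    (hM₀card : M₀.edgeSet.ncard ≤ m)
    (hM₀deg : ∀ v ∈ G.vertexSet, v ≠ z → M₀.degree v < m)
    (hloop : M₀.degree z = m → Even (G.degree z) → Even (G.loopSet z).ncard) :
    ∃ H : Graph α β, H.IsSpanningSubgraph G ∧ H.TreeConnected m ∧
      M ≤ H ∧ Disjoint H.edgeSet M₀.edgeSet ∧
      (∀ v ∈ G.vertexSet, G.degree v / 2 ≤ H.degree v ∧
        H.degree v + M₀.degree v ≤ (G.degree v + 1) / 2 + m) ∧
      H.degree z + M₀.degree z ≤ G.degree z / 2 + max 1 M₀.edgeSet.ncard := by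
  classical
  have : Fintype G.vertexSet := hV.fintype
  have : Fintype G.edgeSet := hE.fintype
  obtain ⟨a, b, hab⟩ := G.exists_ends
  let z' : G.vertexSet := ⟨z, hz⟩
  have : Nonempty G.vertexSet := ⟨z'⟩
  let FM : Finset G.edgeSet := {e | (e : β) ∈ M.edgeSet}
  let FM₀ : Finset G.edgeSet := {e | (e : β) ∈ M₀.edgeSet}
  have hFM : ∀ e : G.edgeSet, e ∈ FM ↔ (e : β) ∈ M.edgeSet := fun e => by simp [FM]
  have hFM₀ : ∀ e : G.edgeSet, e ∈ FM₀ ↔ (e : β) ∈ M₀.edgeSet := fun e => by simp [FM₀]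
  have hdG := Graph.degree_eq_endDegree hab le_rfl univ fun e => by simp
  have hdM := Graph.degree_eq_endDegree hab hM.le FM hFM
  have hdM₀ := Graph.degree_eq_endDegree hab hM₀.le FM₀ hFM₀
  have hloopless : ∀ K : Graph α β, K.Loopless → K ≤ G → ∀ e : G.edgeSet, (e : β) ∈ K.edgeSet →
      a e ≠ b e := fun K hK hKG e he hae =>
    hK.not_isLoopAt e (a e) ((Graph.isLink_iff_of_ends hab hKG e (a e) (a e)).2
      ⟨he, Or.inl ⟨rfl, hae.symm⟩⟩)
  have hM₀E : M₀.edgeSet ⊆ G.edgeSet := fun e he => by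
    obtain ⟨u, w, h⟩ := M₀.exists_isLink_of_mem_edgeSet he
    exact (h.mono hM₀.le).edge_mem
  have hcard : M₀.edgeSet.ncard = #FM₀ := by
    rw [Graph.ncard_eq_card_filter (G := G) M₀.edgeSet (fun _ => True) FM₀ hM₀E
      fun e => by simp [hFM₀], filter_true]
  have hloopcard : (G.loopSet z).ncard = #{e | a e = z' ∧ b e = z'} :=
    Graph.ncard_eq_card_filter _ _ univ (fun e he => Graph.IsLoopAt.edge_mem he) fun e => by
      rw [Graph.mem_loopSet, Graph.IsLoopAt]
      have := Graph.isLink_iff_of_ends hab le_rfl e z' z'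
      simp only [mem_univ, true_and]
      rw [this]
      have := e.2
      tauto
  obtain ⟨T, F, hT1, hT2, hT3, hTF, hMF, hFM₀d, hdeg, hdegz⟩ :=
    exists_trees_and_complement a b m hm z' FM FM₀
      (fun X hX hX' => by
        rw [← Graph.ncard_edgeCut hab]
        refine hG _ ⟨by rintro _ ⟨x, -, rfl⟩; exact x.2, fun h => hX' ?_⟩ ?_
        · refine eq_univ_of_forall fun x => ?_
          obtain ⟨y, hy, hyx⟩ := h x.2
          rwa [← Subtype.ext hyx]
        · exact (coe_nonempty.2 hX).image _)
      (fun e he => hloopless M hMl hM.le e ((hFM e).1 he))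
      (fun e he => hloopless M₀ hM₀l hM₀.le e ((hFM₀ e).1 he))
      (disjoint_left.2 fun e he he' => Set.disjoint_left.1 hdisj ((hFM e).1 he) ((hFM₀ e).1 he'))
      (fun v => by rw [← hdM]; exact hMdeg v v.2)
      (by rwa [← hcard])
      (fun v hv => by rw [← hdM₀]; exact hM₀deg v v.2 fun h => hv (Subtype.ext h))
      (fun h1 h2 => by
        rw [← hloopcard]
        exact hloop ((hdM₀ z').trans h1) (by rw [← hdG] at h2; exact h2))
  let H : Graph α β := G.restrict (Subtype.val '' (F : Set G.edgeSet))
  have hFH : ∀ e : G.edgeSet, e ∈ F ↔ (e : β) ∈ H.edgeSet := fun e => by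
    simp [H, Graph.restrict]
  have hdH := Graph.degree_eq_endDegree hab Graph.restrict_le F hFH
  refine ⟨H, ⟨Graph.restrict_le, rfl⟩, ?_, ?_, ?_, ?_, ?_⟩
  · refine ⟨fun i => G.restrict (Subtype.val '' (T i : Set G.edgeSet)),
      fun i => ⟨⟨⟨le_rfl, ?_⟩, rfl⟩, Graph.isTree_restrict hab (T i) (hT1 i) (hT2 i)⟩, ?_⟩
    · rintro e x y ⟨⟨e, he, rfl⟩, h⟩
      exact ⟨⟨e, hTF i he, rfl⟩, h⟩
    · intro i j hij
      rw [Set.disjoint_left]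
      rintro _ ⟨-, ⟨e, he, rfl⟩⟩ ⟨-, ⟨e', he', hee⟩⟩
      rw [Subtype.ext hee] at he'
      exact disjoint_left.1 (hT3 i j hij) he he'
  · refine ⟨hM.vertexSet_eq.subset, fun e x y h => ?_⟩
    have hGl := h.mono hM.le
    exact ⟨⟨⟨e, hGl.edge_mem⟩, hMF ((hFM ⟨e, hGl.edge_mem⟩).2 h.edge_mem), rfl⟩, hGl⟩
  · rw [Set.disjoint_left]
    rintro _ ⟨-, ⟨e, he, rfl⟩⟩ he'
    exact disjoint_left.1 hFM₀d he ((hFM₀ e).2 he')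
  · intro v hv
    have h1 := hdeg ⟨v, hv⟩
    rwa [← hdG, ← hdH, ← hdM₀] at h1
  · rw [hcard]
    rwa [← hdG, ← hdH, ← hdM₀] at hdegz
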